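/- Let $n\ge 0$ and $A,p\ge 1$ be integers with $n$ even. Write $(x)_{n+1}=x(x+1)\cdots(x+n)$. Let $P\in\mathbb{Q}[X_1,\dots,X_p]$ be a polynomial such that $$P(X_{\sigma(1)},\dots,X_{\sigma(p)})=\varepsilon_\sigma\,P(X_1,\dots,X_p)\quad\text{for every permutation }\sigma\in\mathfrak{S}_p\text{ with signature }\varepsilon_\sigma,$$ $$P(X_1,\dots,X_{j-1},-X_j-n,X_{j+1},\dots,X_p)=(-1)^{A(n+1)+1}P(X_1,\dots,X_p)\quad\text{for every }j\in\{1,\dots,p\},$$ and such that $P$ has degree at most $A(n+1)-2$ in each variable (the zero polynomial having degree $-\infty$). Then the series $$\sum_{k_1\ge k_2\ge\cdots\ge k_p\ge 1}\frac{P(k_1,\dots,k_p)}{(k_1)_{n+1}^A\cdots(k_p)_{n+1}^A}$$ converges (absolutely), and its sum is a linear combination with rational coefficients of products of the form $$\zeta(s_1)\cdots\zeta(s_q)\,\zeta^{\mathrm{as}}(s'_1,\dots,s'_{q'}),$$ where $q,q'\ge 0$ are integers with $2q+q'\le p$, all of $s_1,\dots,s_q,s'_1,\dots,s'_{q'}$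 are odd integers $\ge 3$, $s_i\le 2A-1$ for all $i\in\{1,\dots,q\}$, and $s'_i\le A$ for all $i\in\{1,\dots,q'\}$. Here $\zeta$ is the Riemann zeta function and, for integers $t_1,\dots,t_r\ge 2$, $$\zeta^{\mathrm{as}}(t_1,\dots,t_r)=\sum_{\sigma\in\mathfrak{S}_r}\varepsilon_\sigma\,\zeta(t_{\sigma(1)},\dots,t_{\sigma(r)}),\qquad \zeta(t_1,\dots,t_r)=\sum_{k_1>\cdots>k_r\ge 1}\frac{1}{k_1^{t_1}\cdots k_r^{t_r}},$$ with the convention $\zeta^{\mathrm{as}}=1$ when $r=0$ (and an empty product equals $1$). -/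

import Mathlib

noncomputable section

namespace Polyzeta

/-- The multiple zeta value `ζ(s₁, …, s_p) = ∑_{k₁ > ⋯ > k_p ≥ 1} 1 / (k₁ ^ s₁ ⋯ k_p ^ s_p)`.
It is the sum of a convergent series as soon as `s₁ ≥ 2` and all `s_i ≥ 1`; for `p = 0` it is `1`. -/
def multiZeta {p : ℕ} (s : Fin p → ℕ) : ℝ :=
  ∑' k : {k : Fin p → ℕ // StrictAnti k ∧ ∀ i, 1 ≤ k i}, ∏ i, 1 / (k.1 i : ℝ) ^ s i

/-- The antisymmetric multiple zeta value
`ζ^as(s₁, …, s_p) = ∑_{σ ∈ 𝔖_p} ε_σ ζ(s_{σ(1)}, …, s_{σ(p)})`; for `p = 0` it is `1`. -/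
def antisymZeta {p : ℕ} (s : Fin p → ℕ) : ℝ :=
  ∑ σ : Equiv.Perm (Fin p), ((Equiv.Perm.sign σ : ℤ) : ℝ) * multiZeta (fun i => s (σ i))

/-- The set `𝒜_p` of polynomials `P ∈ ℚ[X₁, …, X_p]` with
`P(X_{σ(1)}, …, X_{σ(p)}) = ε_σ P` for every permutation `σ`, and
`P(X₁, …, X_{j-1}, -X_j - n, X_{j+1}, …, X_p) = (-1)^{A(n+1)+1} P` for every `j`. -/
def polySet (n A p : ℕ) : Set (MvPolynomial (Fin p) ℚ) :=
  {P | (∀ σ : Equiv.Perm (Fin p),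
          MvPolynomial.aeval
            (fun i => (MvPolynomial.X (σ i) : MvPolynomial (Fin p) ℚ)) P =
          ((Equiv.Perm.sign σ : ℤ) : ℚ) • P) ∧
       ∀ j : Fin p,
          MvPolynomial.aeval
            (Function.update (fun i => (MvPolynomial.X i : MvPolynomial (Fin p) ℚ)) j
              (-MvPolynomial.X j - MvPolynomial.C (n : ℚ))) P =
          (-1 : ℚ) ^ (A * (n + 1) + 1) • P}

/-- The term `P(k₁, …, k_p) / ((k₁)_{n+1}^A ⋯ (k_p)_{n+1}^A)`, where
`(x)_{n+1} = x (x + 1) ⋯ (x + n)`. -/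
def seriesTerm (n A : ℕ) {p : ℕ} (P : MvPolynomial (Fin p) ℚ) (k : Fin p → ℕ) : ℝ :=
  MvPolynomial.aeval (fun i => (k i : ℝ)) P /
    ∏ i, (ascPochhammer ℝ (n + 1)).eval (k i : ℝ) ^ A

/-- The products `ζ(s₁) ⋯ ζ(s_q) ζ^as(s'₁, …, s'_{q'})` with `2 q + q' ≤ p`, all `s_i` and `s'_i`
odd and at least `3`, `s_i ≤ 2 A - 1` and `s'_i ≤ A`. The value `ζ(s)` is real for real `s > 1`,
so that taking its real part only changes its type. -/
def zetaProducts (A p : ℕ) : Set ℝ :=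
  {x | ∃ (q q' : ℕ) (s : Fin q → ℕ) (s' : Fin q' → ℕ),
      2 * q + q' ≤ p ∧
      (∀ i, Odd (s i) ∧ 3 ≤ s i ∧ s i ≤ 2 * A - 1) ∧
      (∀ i, Odd (s' i) ∧ 3 ≤ s' i ∧ s' i ≤ A) ∧
      x = (∏ i, (riemannZeta (s i : ℂ)).re) * antisymZeta s'}

end Polyzeta

end

/-! Put n = 2N and x = k + N. Then (k)_{n+1} becomes D(x) = ∏_{|j| ≤ N} (x + j), which is odd in x,
and the reflection k ↦ -k - n becomes x ↦ -x. Averaging the monomials of P over all reflections and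
antisymmetrizing over permutations writes the summand as a rational combination of determinants
det(R_i(x_j)), where R_i = Q_i / D^A is an odd rational function of degree at most -2
(`seriesTerm_eq`). Antisymmetry kills every tuple with a repeated entry, so only strictly decreasing
tuples matter.

Partial fractions reduce each R_i to powers 1/x^a with 3 ≤ a ≤ A odd, plus differences g(x) = h(x) -
h(x+1) produced by moving the poles to 0 (`ratioFun_mem_span`, `truncPow_mem_span_gens`). At 0 the
even powers cancel by oddness, and 1/x cancels because the residues sum to 0.

The heart is a Pfaffian-type expansion (`orderedSum_cons`, `listDetSum_cons`). The sum of
det(f_i(k_j)) over k_1 > ⋯ > k_p ≥ 1 is an alternating form in the f_i. Its contraction by g is (∑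
g) times the form in the remaining functions, plus the wedge of that form with c_g(f) = -∑ (S_g(x) +
S_g(x-1)) f(x), where S_g denotes partial sums. If g is a difference as above, ∑ g = h(1) is
rational and S_g(x) + S_g(x-1) = 2h(1) - (h(x) + h(x+1)). For the differences used here h(x) +
h(x+1) is even for x > N, so its product with f is odd with denominator D^{2A}; hence c_g(f)
involves only 1 and ζ(s) with s odd, s ≤ 2A - 1 (`infPairing_mem`).

Thus each expansion removes either g alone, at a rational cost, or g and one other function, at the
cost of one zeta value; this gives 2q + q' ≤ p. Once only pure powers remain, the determinant sum is
ζ^as by definition (`listDetSum_mem_span`). -/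

namespace Polyzeta

/-! ### Exterior product with a linear form. -/

section Wedge

variable {F : Type*}

/-- The exterior product of a linear form `c` with an alternating form `Φ`, both regarded as
functions on lists of vectors. -/
def wedge (c : F → ℝ) (Φ : List F → ℝ) : List F → ℝ
  | [] => 0
  | d :: l => c d * Φ l - wedge c (fun l' => Φ (d :: l')) l
termination_by l => l.length

theorem wedge_nil (c : F → ℝ) (Φ : List F → ℝ) : wedge c Φ [] = 0 := by
  rw [wedge]

theorem wedge_cons (c : F → ℝ) (Φ : List F → ℝ) (d : F) (l : List F) :
    wedge c Φ (d :: l) = c d * Φ l - wedge c (fun l' => Φ (d :: l')) l := by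
  rw [wedge]

theorem wedge_linear_right (c : F → ℝ) (r s : ℝ) (Φ Ψ : List F → ℝ) (l : List F) :
    wedge c (fun l' => r * Φ l' + s * Ψ l') l = r * wedge c Φ l + s * wedge c Ψ l := by
  induction l generalizing Φ Ψ with
  | nil => simp [wedge_nil]
  | cons d l ih => simp only [wedge_cons, ih]; ring

theorem wedge_linear_left (c c' : F → ℝ) (r s : ℝ) (Φ : List F → ℝ) (l : List F) :
    wedge (fun f => r * c f + s * c' f) Φ l = r * wedge c Φ l + s * wedge c' Φ l := by
  induction l generalizing Φ with
  | nil => simp [wedge_nil]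
  | cons d l ih => simp only [wedge_cons, ih]; ring

theorem wedge_add_right (c : F → ℝ) (Φ Ψ : List F → ℝ) (l : List F) :
    wedge c (fun l' => Φ l' + Ψ l') l = wedge c Φ l + wedge c Ψ l := by
  simpa using wedge_linear_right c 1 1 Φ Ψ l

/-- Contraction by the first vector is an antiderivation: on a ∧ b ∧ Φ it yields two terms swapped
with opposite signs by a ↔ b, plus a ∧ b ∧ (contracted Φ), to which induction applies. -/
theorem wedge_anticomm (c c' : F → ℝ) (Φ : List F → ℝ) (l : List F) :
    wedge c (wedge c' Φ) l = -wedge c' (wedge c Φ) l := by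
  induction l generalizing Φ with
  | nil => simp [wedge_nil]
  | cons d l ih =>
    have key : ∀ a b : F → ℝ, wedge a (wedge b Φ) (d :: l) =
        a d * wedge b Φ l - b d * wedge a Φ l +
          wedge a (wedge b (fun l' => Φ (d :: l'))) l := by
      intro a b
      have h := wedge_linear_right a (b d) (-1) Φ (wedge b (fun l' => Φ (d :: l'))) l
      rw [wedge_cons]
      simp only [wedge_cons]
      simp only [neg_mul, one_mul, ← sub_eq_add_neg] at h
      rw [h]; ring
    rw [key, key, ih]; ring

theorem wedge_self (c : F → ℝ) (Φ : List F → ℝ) (l : List F) : wedge c (wedge c Φ) l = 0 := by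
  linarith [wedge_anticomm c c Φ l]

theorem wedge_mem {R : Type*} [Ring R] [Module R ℝ] (Y : Submodule R ℝ) (c : F → ℝ)
    (Φ : List F → ℝ) (l : List F)
    (h : ∀ l₁ d l₂, l = l₁ ++ d :: l₂ → c d * Φ (l₁ ++ l₂) ∈ Y) : wedge c Φ l ∈ Y := by
  induction l generalizing Φ with
  | nil => rw [wedge_nil]; exact Y.zero_mem
  | cons d l ih =>
    rw [wedge_cons]
    refine Y.sub_mem (by simpa using h [] d l rfl) (ih _ fun l₁ d' l₂ hl => ?_)
    simpa using h (d :: l₁) d' l₂ (by simp [hl])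

open Filter Topology in
theorem tendsto_wedge (c : ℕ → F → ℝ) (c' : F → ℝ) (Φ : ℕ → List F → ℝ) (Φ' : List F → ℝ)
    (hc : ∀ f, Tendsto (fun M => c M f) atTop (𝓝 (c' f)))
    (hΦ : ∀ l, Tendsto (fun M => Φ M l) atTop (𝓝 (Φ' l))) (l : List F) :
    Tendsto (fun M => wedge (c M) (Φ M) l) atTop (𝓝 (wedge c' Φ' l)) := by
  induction l generalizing Φ Φ' with
  | nil => simp [wedge_nil]
  | cons d l ih =>
    simp only [wedge_cons]
    exact ((hc d).mul (hΦ l)).sub (ih _ _ fun l' => hΦ (d :: l'))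

theorem wedge_ofFn (c : F → ℝ) (Φ : List F → ℝ) {p : ℕ} (f : Fin (p + 1) → F) :
    wedge c Φ (List.ofFn f) =
      ∑ i : Fin (p + 1), (-1) ^ (i : ℕ) * c (f i) *
        Φ (List.ofFn fun j => f (i.succAbove j)) := by
  induction p generalizing Φ with
  | zero => simp [wedge_cons, wedge_nil]
  | succ p ih =>
    rw [List.ofFn_succ, wedge_cons, ih, Fin.sum_univ_succ (n := p + 1), sub_eq_add_neg,
      ← Finset.sum_neg_distrib]
    congr 1
    · simp
    · refine Finset.sum_congr rfl fun i _ => ?_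
      rw [List.ofFn_succ (n := p)]
      simp [pow_succ]

end Wedge

/-! ### Finite ordered sums of determinants and their Pfaffian expansion. -/

section OrderedSums

variable {F : Type*} (ev : F → ℕ → ℝ)

/-- The determinants `det (f_i (k_j))` summed over `M ≥ k₁ > ⋯ > k_p ≥ 1`, as a function of the
list of the `f_i`; see `orderedSum_ofFn`. -/
def orderedSum : ℕ → List F → ℝ
  | 0 => fun l => if l.isEmpty then 1 else 0
  | M + 1 => fun l => orderedSum M l + wedge (fun f => ev f (M + 1)) (orderedSum M) l

/-- The sum of the values at `1, …, M`. -/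
def partialSum (g : F) (M : ℕ) : ℝ := ∑ x ∈ Finset.range M, ev g (x + 1)

/-- The contraction of the ordered sums by `g`, as a linear form. -/
def pairing (g : F) (M : ℕ) (f : F) : ℝ :=
  -∑ x ∈ Finset.range M, (partialSum ev g (x + 1) + partialSum ev g x) * ev f (x + 1)

theorem orderedSum_nil (M : ℕ) : orderedSum ev M [] = 1 := by
  induction M with
  | zero => simp [orderedSum]
  | succ M ih => simp [orderedSum, wedge_nil, ih]

/-- The Pfaffian expansion of the ordered sums along the first function. -/
theorem orderedSum_cons (g : F) (M : ℕ) (l : List F) :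
    orderedSum ev M (g :: l) = partialSum ev g M * orderedSum ev M l +
      wedge (pairing ev g M) (orderedSum ev M) l := by
  induction M generalizing l with
  | zero =>
    have h : pairing ev g 0 = fun f => (0 : ℝ) * ev f 0 + 0 * ev f 0 := by
      funext f; simp [pairing]
    rw [h, wedge_linear_left]
    simp [orderedSum, partialSum]
  | succ M ih =>
    set v : F → ℝ := fun f => ev f (M + 1) with hv
    set h := partialSum ev g M with hh
    set c := pairing ev g M with hc
    set Φ := orderedSum ev M with hΦ
    have hS : partialSum ev g (M + 1) = h + v g := by
      simp [partialSum, Finset.sum_range_succ, hh, hv]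
    -- The new summand of the pairing has weight S_g(M+1) + S_g(M) = 2h + v(g), so the linear form
    -- changes by a multiple of v.
    have hp : pairing ev g (M + 1) = fun f => 1 * c f + (-(2 * h + v g)) * v f := by
      funext f
      simp only [pairing, Finset.sum_range_succ, hc, hS, hv, ← hh]
      ring
    have e1 : orderedSum ev (M + 1) = fun l => Φ l + wedge v Φ l := rfl
    have e2 : (fun l' => Φ (g :: l')) = fun l' => h * Φ l' + 1 * wedge c Φ l' := by
      funext l'; rw [ih, one_mul]
    -- Since v ∧ v = 0 and c ∧ v = -v ∧ c, it remains to compare the coefficients of v ∧ Φ: (h +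
    -- v(g)) - (2h + v(g)) = -h.
    rw [hS, hp, wedge_linear_left, e1, wedge_add_right, wedge_add_right]
    simp only [wedge_cons]
    rw [e2, wedge_linear_right, ih, wedge_self, wedge_anticomm v c]
    ring

end OrderedSums

/-! ### Determinant sums over decreasing tuples, and passage to the limit. -/

section Tuples

open Filter Topology

/-- The tuples `M ≥ k₁ > ⋯ > k_p ≥ 1`. -/
def strictBox (p M : ℕ) : Finset (Fin p → ℕ) :=
  (Fintype.piFinset fun _ => Finset.range (M + 1)).filter
    fun k => StrictAnti k ∧ ∀ i, 1 ≤ k i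

theorem mem_strictBox {p M : ℕ} {k : Fin p → ℕ} :
    k ∈ strictBox p M ↔ (∀ i, k i ≤ M) ∧ StrictAnti k ∧ ∀ i, 1 ≤ k i := by
  simp [strictBox]

theorem strictAnti_cons {p : ℕ} (a : ℕ) (k : Fin p → ℕ) :
    StrictAnti (Fin.cons a k : Fin (p + 1) → ℕ) ↔ (∀ i, k i < a) ∧ StrictAnti k := by
  constructor
  · intro h
    refine ⟨fun i => by simpa using h (Fin.succ_pos i), fun i j hij => ?_⟩
    simpa using h (Fin.succ_lt_succ_iff.2 hij)
  · rintro ⟨h₁, h₂⟩ i j hij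
    refine Fin.cases (fun hij => ?_) (fun i hij => ?_) i hij
    · obtain ⟨j, rfl⟩ := Fin.exists_succ_eq.2 hij.ne'
      simpa using h₁ j
    · obtain ⟨j, rfl⟩ := Fin.exists_succ_eq.2 ((Fin.succ_pos i).trans hij).ne'
      simpa using h₂ (Fin.succ_lt_succ_iff.1 hij)

theorem strictBox_succ_succ (p M : ℕ) :
    strictBox (p + 1) (M + 1) = strictBox (p + 1) M ∪
      (strictBox p M).image fun k => (Fin.cons (M + 1) k : Fin (p + 1) → ℕ) := by
  ext k
  obtain ⟨a, k, rfl⟩ : ∃ a k', k = (Fin.cons a k' : Fin (p + 1) → ℕ) :=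
    ⟨k 0, Fin.tail k, (Fin.cons_self_tail k).symm⟩
  simp only [Finset.mem_union, Finset.mem_image, mem_strictBox, strictAnti_cons, Fin.forall_fin_succ,
    Fin.cons_zero, Fin.cons_succ, Fin.cons_inj]
  constructor
  · rintro ⟨⟨ha, hk⟩, ⟨h1, h2⟩, h3, h4⟩
    rcases ha.lt_or_eq with h | rfl
    · exact Or.inl ⟨⟨by omega, fun i => by have := h1 i; omega⟩, ⟨h1, h2⟩, h3, h4⟩
    · exact Or.inr ⟨k, ⟨fun i => by have := h1 i; omega, h2, h4⟩, rfl, rfl⟩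
  · rintro (⟨⟨ha, hk⟩, ⟨h1, h2⟩, h3, h4⟩ | ⟨k', ⟨h1, h2, h3⟩, rfl, rfl⟩)
    · exact ⟨⟨by omega, fun i => by have := hk i; omega⟩, ⟨h1, h2⟩, h3, h4⟩
    · exact ⟨⟨le_rfl, fun i => by have := h1 i; omega⟩,
        ⟨fun i => by have := h1 i; omega, h2⟩, by omega, h3⟩

theorem disjoint_strictBox_image (p M : ℕ) :
    Disjoint (strictBox (p + 1) M)
      ((strictBox p M).image fun k => (Fin.cons (M + 1) k : Fin (p + 1) → ℕ)) := by
  rw [Finset.disjoint_left]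
  intro k hk hk'
  obtain ⟨k', -, rfl⟩ := Finset.mem_image.1 hk'
  have := (mem_strictBox.1 hk).1 0
  simp at this

variable {F : Type*} (ev : F → ℕ → ℝ)

/-- The determinant `det (f_i (k_j))`. -/
def evalDet {p : ℕ} (f : Fin p → ℕ → ℝ) (k : Fin p → ℕ) : ℝ :=
  (Matrix.of fun i j => f i (k j)).det

/-- The tuples new at M + 1 are those with k₁ = M + 1; expanding their determinants along the first
column gives exactly the wedge with evaluation at M + 1. -/
theorem orderedSum_ofFn (M : ℕ) {p : ℕ} (f : Fin p → F) :
    orderedSum ev M (List.ofFn f) = ∑ k ∈ strictBox p M, evalDet (fun i => ev (f i)) k := by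
  induction M generalizing p with
  | zero =>
    cases p with
    | zero =>
      have : strictBox 0 0 = Finset.univ := by
        ext k; simp [mem_strictBox, Subsingleton.strictAnti, eq_iff_true_of_subsingleton]
      simp [orderedSum, evalDet, this]
    | succ p =>
      have : strictBox (p + 1) 0 = ∅ := by
        ext k
        simp only [mem_strictBox, Finset.notMem_empty, iff_false]
        rintro ⟨h1, -, h2⟩
        have := h1 0
        have := h2 0
        omega
      simp [orderedSum, this]
  | succ M ih =>
    cases p with
    | zero =>
      have : strictBox 0 (M + 1) = Finset.univ := by
        ext k; simp [mem_strictBox, Subsingleton.strictAnti, eq_iff_true_of_subsingleton]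
      simp [orderedSum_nil, evalDet, this]
    | succ p =>
      rw [strictBox_succ_succ, Finset.sum_union (disjoint_strictBox_image p M), ← ih,
        Finset.sum_image fun k _ k' _ h => (Fin.cons_inj.1 h).2]
      change orderedSum ev M _ + wedge _ _ _ = _
      rw [wedge_ofFn]
      congr 1
      simp only [evalDet, Matrix.det_succ_column_zero, ih]
      rw [Finset.sum_comm]
      refine Finset.sum_congr rfl fun i _ => ?_
      rw [Finset.mul_sum]
      refine Finset.sum_congr rfl fun k _ => ?_
      simp [Matrix.submatrix, Matrix.of_apply]

theorem summable_prod_apply {p : ℕ} (f : Fin p → ℕ → ℝ) (hf : ∀ i, Summable (f i)) :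
    Summable fun k : Fin p → ℕ => ∏ i, |f i (k i)| := by
  induction p with
  | zero => exact (hasSum_fintype _).summable
  | succ p ih =>
    have h := (hf 0).abs.mul_of_nonneg (ih (fun i => f i.succ) fun i => hf i.succ)
      (fun _ => abs_nonneg _) fun _ => Finset.prod_nonneg fun _ _ => abs_nonneg _
    rw [← (Fin.consEquiv fun _ : Fin (p + 1) => ℕ).summable_iff]
    refine h.congr fun x => ?_
    simp [Fin.prod_univ_succ, Fin.consEquiv]

theorem summable_evalDet {p : ℕ} (f : Fin p → ℕ → ℝ) (hf : ∀ i, Summable (f i)) :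
    Summable (evalDet f) := by
  have : evalDet f = fun k => ∑ σ : Equiv.Perm (Fin p),
      ((Equiv.Perm.sign σ : ℤ) : ℝ) * ∏ i, f (σ i) (k i) := by
    funext k; simp [evalDet, Matrix.det_apply']
  rw [this]
  refine summable_sum fun σ _ => Summable.mul_left _ (Summable.of_norm ?_)
  refine (summable_prod_apply (fun i => f (σ i)) fun i => hf _).congr fun k => ?_
  rw [Real.norm_eq_abs, Finset.abs_prod]

/-- The tuples `k₁ > ⋯ > k_p ≥ 1`. -/
def strictTuples (p : ℕ) : Set (Fin p → ℕ) := {k | StrictAnti k ∧ ∀ i, 1 ≤ k i}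

/-- The sum of `det (f_i (k_j))` over all `k₁ > ⋯ > k_p ≥ 1`. -/
noncomputable def detSum {p : ℕ} (f : Fin p → ℕ → ℝ) : ℝ :=
  ∑' k : strictTuples p, evalDet f k

theorem hasSum_detSum {p : ℕ} (f : Fin p → ℕ → ℝ) (hf : ∀ i, Summable (f i)) :
    HasSum (fun k : strictTuples p => evalDet f k) (detSum f) :=
  ((summable_evalDet f hf).subtype _).hasSum

theorem tendsto_orderedSum_ofFn (hev : ∀ f, Summable (ev f)) {p : ℕ} (f : Fin p → F) :
    Tendsto (fun M => orderedSum ev M (List.ofFn f)) atTop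
      (𝓝 (detSum fun i => ev (f i))) := by
  have h := hasSum_detSum (fun i => ev (f i)) fun i => hev (f i)
  have h' := (hasSum_subtype_iff_indicator (f := evalDet fun i => ev (f i))).1 h
  have hmono : Monotone fun M => (Fintype.piFinset fun _ : Fin p => Finset.range (M + 1)) :=
    fun M M' h => Fintype.piFinset_subset _ _ fun _ => Finset.range_mono (by omega)
  -- The cubes exhaust all tuples: k lies in the cube of side ∑ i, k i.
  have hbox := tendsto_atTop_finset_of_monotone hmono fun k => ⟨∑ i, k i, by
    simp only [Fintype.mem_piFinset, Finset.mem_range, Nat.lt_succ_iff]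
    exact fun i => Finset.single_le_sum (f := k) (fun _ _ => Nat.zero_le _) (Finset.mem_univ i)⟩
  refine (h'.comp hbox).congr fun M => ?_
  rw [orderedSum_ofFn, strictBox, Finset.sum_filter]
  refine Finset.sum_congr rfl fun k _ => ?_
  simp [Set.indicator_apply, strictTuples]

/-- `detSum` for a list of functions. -/
noncomputable def listDetSum (l : List F) : ℝ := detSum fun i => ev (l.get i)

theorem listDetSum_ofFn {p : ℕ} (hev : ∀ f, Summable (ev f)) (f : Fin p → F) :
    listDetSum ev (List.ofFn f) = detSum fun i => ev (f i) := by
  refine tendsto_nhds_unique ?_ (tendsto_orderedSum_ofFn ev hev f)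
  simpa [listDetSum, List.ofFn_get] using
    tendsto_orderedSum_ofFn ev hev fun i => (List.ofFn f).get i

theorem tendsto_orderedSum (hev : ∀ f, Summable (ev f)) (l : List F) :
    Tendsto (fun M => orderedSum ev M l) atTop (𝓝 (listDetSum ev l)) := by
  simpa [listDetSum, List.ofFn_get] using tendsto_orderedSum_ofFn ev hev fun i => l.get i

/-- The limit of `pairing`. -/
noncomputable def infPairing (g f : F) : ℝ :=
  -∑' x, (partialSum ev g (x + 1) + partialSum ev g x) * ev f (x + 1)

theorem tendsto_partialSum (hev : ∀ f, Summable (ev f)) (g : F) :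
    Tendsto (partialSum ev g) atTop (𝓝 (∑' x, ev g (x + 1))) :=
  ((summable_nat_add_iff 1).2 (hev g)).hasSum.tendsto_sum_nat

theorem summable_infPairing (hev : ∀ f, Summable (ev f)) (g f : F) :
    Summable fun x => (partialSum ev g (x + 1) + partialSum ev g x) * ev f (x + 1) := by
  obtain ⟨C, hC⟩ := (tendsto_partialSum ev hev g).norm.bddAbove_range
  have hC' : ∀ x, ‖partialSum ev g x‖ ≤ C := fun x => hC ⟨x, rfl⟩
  refine Summable.of_norm_bounded (g := fun x => (C + C) * |ev f (x + 1)|)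
    (((summable_nat_add_iff 1).2 (hev f)).abs.mul_left _) fun x => ?_
  rw [norm_mul, Real.norm_eq_abs (ev f (x + 1))]
  exact mul_le_mul_of_nonneg_right ((norm_add_le _ _).trans (add_le_add (hC' _) (hC' _)))
    (abs_nonneg _)

theorem tendsto_pairing (hev : ∀ f, Summable (ev f)) (g f : F) :
    Tendsto (fun M => pairing ev g M f) atTop (𝓝 (infPairing ev g f)) :=
  (summable_infPairing ev hev g f).hasSum.tendsto_sum_nat.neg

/-- The Pfaffian expansion of `listDetSum` along the first function. -/
theorem listDetSum_cons (hev : ∀ f, Summable (ev f)) (g : F) (l : List F) :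
    listDetSum ev (g :: l) = (∑' x, ev g (x + 1)) * listDetSum ev l +
      wedge (infPairing ev g) (listDetSum ev) l := by
  refine tendsto_nhds_unique (tendsto_orderedSum ev hev (g :: l)) ?_
  simp only [orderedSum_cons]
  exact ((tendsto_partialSum ev hev g).mul (tendsto_orderedSum ev hev l)).add
    (tendsto_wedge _ _ _ _ (tendsto_pairing ev hev g) (tendsto_orderedSum ev hev) l)

end Tuples

/-! ### Rational spans of zeta values and of the target products. -/

section Spans

/-- The rational span of `1` and of the `ζ(s)` with `3 ≤ s ≤ B` odd. -/
noncomputable def oddZetaSpan (B : ℕ) : Submodule ℚ ℝ :=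
  Submodule.span ℚ
    (insert 1 {x | ∃ s : ℕ, Odd s ∧ 3 ≤ s ∧ s ≤ B ∧ x = (riemannZeta (s : ℂ)).re})

theorem ratCast_mem_oddZetaSpan (B : ℕ) (r : ℚ) : (r : ℝ) ∈ oddZetaSpan B := by
  have := (oddZetaSpan B).smul_mem r (Submodule.subset_span (Set.mem_insert _ _))
  simpa [Rat.smul_def] using this

theorem ratCast_mul_mem {Y : Submodule ℚ ℝ} (r : ℚ) {x : ℝ} (hx : x ∈ Y) : (r : ℝ) * x ∈ Y := by
  simpa [Rat.smul_def] using Y.smul_mem r hx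

theorem zetaProducts_mono (A : ℕ) {p p' : ℕ} (h : p ≤ p') :
    zetaProducts A p ⊆ zetaProducts A p' := by
  rintro x ⟨q, q', s, s', h1, h2⟩
  exact ⟨q, q', s, s', h1.trans h, h2⟩

/-- A further factor ζ(t) raises q by one, hence 2q + q' by two. -/
theorem mul_mem_span_zetaProducts (A p : ℕ) {z y : ℝ} (hz : z ∈ oddZetaSpan (2 * A - 1))
    (hy : y ∈ Submodule.span ℚ (zetaProducts A p)) :
    z * y ∈ Submodule.span ℚ (zetaProducts A (p + 2)) := by
  induction hz using Submodule.span_induction with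
  | zero => simp
  | add z z' _ _ h h' => rw [add_mul]; exact add_mem h h'
  | smul r z _ h => rw [smul_mul_assoc]; exact Submodule.smul_mem _ r h
  | mem z hz =>
    rcases hz with rfl | ⟨t, ht, ht3, htB, rfl⟩
    · rw [one_mul]
      exact Submodule.span_mono (zetaProducts_mono A (by omega)) hy
    · induction hy using Submodule.span_induction with
      | zero => simp
      | add z z' _ _ h h' => rw [mul_add]; exact add_mem h h'
      | smul r z _ h => rw [mul_smul_comm]; exact Submodule.smul_mem _ r h
      | mem y hy =>
        obtain ⟨q, q', s, s', h1, h2, h3, rfl⟩ := hy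
        refine Submodule.subset_span ⟨q + 1, q', Fin.cons t s, s', by omega, ?_, h3, ?_⟩
        · exact Fin.cases ⟨ht, ht3, htB⟩ h2
        · simp [Fin.prod_univ_succ, mul_assoc]

theorem antisymZeta_mem_span (A : ℕ) {p : ℕ} (s : Fin p → ℕ)
    (hs : ∀ i, Odd (s i) ∧ 3 ≤ s i ∧ s i ≤ A) :
    antisymZeta s ∈ Submodule.span ℚ (zetaProducts A p) :=
  Submodule.subset_span ⟨0, p, Fin.elim0, s, by omega, fun i => i.elim0, hs, by simp⟩

theorem detSum_one_div_pow {p : ℕ} (s : Fin p → ℕ) (hs : ∀ i, 2 ≤ s i) :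
    detSum (fun i x => 1 / (x : ℝ) ^ s i) = antisymZeta s := by
  have hsum : ∀ i, Summable fun x : ℕ => 1 / (x : ℝ) ^ s i := fun i =>
    Real.summable_one_div_nat_pow.2 (hs i)
  have hprod : ∀ σ : Equiv.Perm (Fin p), Summable fun k : strictTuples p =>
      ∏ i, 1 / (k.1 i : ℝ) ^ s (σ i) := fun σ => by
    refine Summable.subtype (f := fun k : Fin p → ℕ => ∏ i, 1 / (k i : ℝ) ^ s (σ i)) ?_ _
    refine (summable_prod_apply _ fun i => hsum (σ i)).congr fun k => ?_
    refine Finset.prod_congr rfl fun i _ => ?_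
    exact (abs_of_nonneg (by positivity))
  unfold detSum antisymZeta multiZeta
  simp only [evalDet, Matrix.det_apply', Matrix.of_apply]
  rw [Summable.tsum_finsetSum fun σ _ => (hprod σ).mul_left _]
  refine Finset.sum_congr rfl fun σ _ => ?_
  rw [tsum_mul_left]
  rfl

end Spans

/-! ### Eliminating the functions that can be contracted. -/

section Reduction

variable {F : Type*} (ev : F → ℕ → ℝ) (G : Set F) (A : ℕ)

/-- `G` is the set of functions along which one may expand. The `Pairwise` condition places them
first in the list and passes to sublists, so the head can be expanded until no element of `G` is
left. -/
theorem listDetSum_mem_span (hev : ∀ f, Summable (ev f))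
    (hrat : ∀ g ∈ G, ∃ r : ℚ, ∑' x, ev g (x + 1) = r)
    (hpair : ∀ g ∈ G, ∀ f, infPairing ev g f ∈ oddZetaSpan (2 * A - 1))
    (hbase : ∀ f ∉ G, ∃ a : ℕ, Odd a ∧ 3 ≤ a ∧ a ≤ A ∧ ev f = fun x : ℕ => 1 / (x : ℝ) ^ a)
    (n : ℕ) (l : List F) (hn : l.length = n) (hl : l.Pairwise fun f f' => f ∉ G → f' ∉ G) :
    listDetSum ev l ∈ Submodule.span ℚ (zetaProducts A n) := by
  induction n using Nat.strong_induction_on generalizing l with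
  | _ n ih =>
    by_cases hall : ∀ f ∈ l, f ∉ G
    · choose a ha using hbase
      subst hn
      have : listDetSum ev l = antisymZeta fun i => a (l.get i) (hall _ (l.get_mem i)) := by
        rw [← detSum_one_div_pow]
        · unfold listDetSum
          congr 1
          funext i
          exact (ha _ (hall _ (l.get_mem i))).2.2.2
        · intro i
          have := (ha _ (hall _ (l.get_mem i))).2.1
          omega
      rw [this]
      exact antisymZeta_mem_span A _ fun i =>
        have h := ha _ (hall _ (l.get_mem i))
        ⟨h.1, h.2.1, h.2.2.1⟩
    · obtain _ | ⟨g, l⟩ := l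
      · simp at hall
      have hg : g ∈ G := by
        by_contra hg
        refine hall fun f hf => ?_
        rcases List.mem_cons.1 hf with rfl | hf
        · exact hg
        · exact (List.pairwise_cons.1 hl).1 f hf hg
      obtain ⟨r, hr⟩ := hrat g hg
      have hl' := (List.pairwise_cons.1 hl).2
      simp only [List.length_cons] at hn
      rw [listDetSum_cons ev hev, hr]
      refine add_mem (ratCast_mul_mem r ?_) (wedge_mem _ _ _ _ fun l₁ d l₂ h => ?_)
      · exact Submodule.span_mono (zetaProducts_mono A (by omega))
          (ih l.length (by omega) l rfl hl')
      · have hlen : l.length = (l₁ ++ l₂).length + 1 := by simp [h]; omega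
        have hsub : (l₁ ++ l₂).Sublist l := by
          rw [h]; exact (List.Sublist.refl l₁).append (List.sublist_cons_self d l₂)
        have := mul_mem_span_zetaProducts A _ (hpair g hg d)
          (ih (l₁ ++ l₂).length (by omega) _ rfl (hl'.sublist hsub))
        rwa [show (l₁ ++ l₂).length + 2 = n by omega] at this

theorem evalDet_perm {p : ℕ} (f : Fin p → ℕ → ℝ) (σ : Equiv.Perm (Fin p)) (k : Fin p → ℕ) :
    evalDet (fun i => f (σ i)) k = ((Equiv.Perm.sign σ : ℤ) : ℝ) * evalDet f k := by
  simpa [evalDet, Matrix.submatrix] using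
    Matrix.det_permute σ (Matrix.of fun i j => f i (k j))

theorem detSum_perm {p : ℕ} (f : Fin p → ℕ → ℝ) (σ : Equiv.Perm (Fin p)) :
    detSum (fun i => f (σ i)) = ((Equiv.Perm.sign σ : ℤ) : ℝ) * detSum f := by
  simp only [detSum, evalDet_perm, tsum_mul_left]

/-- Sorting the functions so that those of `G` come first changes the sum only by a sign. -/
theorem detSum_mem_span (hev : ∀ f, Summable (ev f))
    (hrat : ∀ g ∈ G, ∃ r : ℚ, ∑' x, ev g (x + 1) = r)
    (hpair : ∀ g ∈ G, ∀ f, infPairing ev g f ∈ oddZetaSpan (2 * A - 1))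
    (hbase : ∀ f ∉ G, ∃ a : ℕ, Odd a ∧ 3 ≤ a ∧ a ≤ A ∧ ev f = fun x : ℕ => 1 / (x : ℝ) ^ a)
    {p : ℕ} (f : Fin p → F) :
    detSum (fun i => ev (f i)) ∈ Submodule.span ℚ (zetaProducts A p) := by
  classical
  let key : Fin p → ℕ := fun i => if f i ∈ G then 0 else 1
  let σ := Tuple.sort key
  have hσ : Monotone (key ∘ σ) := Tuple.monotone_sort key
  have h : listDetSum ev (List.ofFn fun i => f (σ i)) ∈ Submodule.span ℚ (zetaProducts A p) := by
    refine listDetSum_mem_span ev G A hev hrat hpair hbase p _ (List.length_ofFn) ?_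
    rw [List.pairwise_ofFn]
    intro i j hij hi hj
    have := hσ hij.le
    simp [key, hi, hj] at this
  rw [listDetSum_ofFn ev hev, detSum_perm (fun i => ev (f i)) σ] at h
  have h2 := ratCast_mul_mem ((Equiv.Perm.sign σ : ℤ) : ℚ) h
  rw [← mul_assoc] at h2
  rcases Int.units_eq_one_or (Equiv.Perm.sign σ) with hs | hs <;> simpa [hs] using h2

end Reduction

/-! ### Extension from generators to their span by multilinearity. -/

section Multilinear

theorem evalDet_update_add {p : ℕ} (f : Fin p → ℕ → ℝ) (i : Fin p) (y y' : ℕ → ℝ)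
    (k : Fin p → ℕ) : evalDet (Function.update f i (y + y')) k =
      evalDet (Function.update f i y) k + evalDet (Function.update f i y') k := by
  have h : ∀ z : ℕ → ℝ, (Matrix.of fun a j => Function.update f i z a (k j)) =
      (Matrix.of fun a j => f a (k j)).updateRow i fun j => z (k j) := by
    intro z; ext a j
    by_cases hai : a = i
    · subst hai; simp
    · simp [hai]
  simp only [evalDet, h]
  exact Matrix.det_updateRow_add _ _ _ _

theorem evalDet_update_smul {p : ℕ} (f : Fin p → ℕ → ℝ) (i : Fin p) (r : ℚ) (y : ℕ → ℝ)
    (k : Fin p → ℕ) : evalDet (Function.update f i (r • y)) k =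
      r • evalDet (Function.update f i y) k := by
  have h : ∀ z : ℕ → ℝ, (Matrix.of fun a j => Function.update f i z a (k j)) =
      (Matrix.of fun a j => f a (k j)).updateRow i fun j => z (k j) := by
    intro z; ext a j
    by_cases hai : a = i
    · subst hai; simp
    · simp [hai]
  simp only [evalDet, h, Rat.smul_def]
  rw [← Matrix.det_updateRow_smul]
  congr 1

theorem exists_hasSum_evalDet {p : ℕ} (gens : Set (ℕ → ℝ)) (Y : Submodule ℚ ℝ)
    (h : ∀ f : Fin p → ℕ → ℝ, (∀ i, f i ∈ gens) →
      ∃ S ∈ Y, HasSum (fun k : strictTuples p => evalDet f k) S)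
    (f : Fin p → ℕ → ℝ) (hf : ∀ i, f i ∈ Submodule.span ℚ gens) :
    ∃ S ∈ Y, HasSum (fun k : strictTuples p => evalDet f k) S := by
  -- `s` is the set of rows allowed to range over the span; it grows one row at a time, convergence
  -- being carried along with the value.
  suffices H : ∀ s : Finset (Fin p), ∀ f : Fin p → ℕ → ℝ, (∀ i ∈ s, f i ∈ Submodule.span ℚ gens) →
      (∀ i ∉ s, f i ∈ gens) → ∃ S ∈ Y, HasSum (fun k : strictTuples p => evalDet f k) S from
    H Finset.univ f (fun i _ => hf i) (by simp)
  intro s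
  induction s using Finset.induction_on with
  | empty => intro f _ hf; exact h f fun i => hf i (by simp)
  | insert i s his ih =>
    intro f hf hf'
    rw [← Function.update_eq_self i f]
    have hi := hf i (Finset.mem_insert_self _ _)
    generalize f i = y at hi
    induction hi using Submodule.span_induction with
    | mem y hy =>
      refine ih _ (fun j hj => ?_) fun j hj => ?_
      · have hji : j ≠ i := by rintro rfl; exact his hj
        simpa [hji] using hf j (Finset.mem_insert_of_mem hj)
      · by_cases hji : j = i
        · subst hji; simpa using hy
        · simpa [hji] using hf' j (by simp [hji, hj])
    | zero =>
      refine ⟨0, Y.zero_mem, ?_⟩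
      have := fun k => evalDet_update_smul f i 0 0 k
      simp only [zero_smul] at this
      simp only [this]
      exact hasSum_zero
    | add y y' _ _ hy hy' =>
      obtain ⟨S, hS, h1⟩ := hy
      obtain ⟨S', hS', h2⟩ := hy'
      exact ⟨S + S', Y.add_mem hS hS', by simpa only [evalDet_update_add] using h1.add h2⟩
    | smul r y _ hy =>
      obtain ⟨S, hS, h1⟩ := hy
      exact ⟨r • S, Y.smul_mem r hS, by
        simpa only [evalDet_update_smul] using h1.const_smul r⟩

end Multilinear

/-! ### Partial fractions of odd rational functions. -/

section PartialFractions

open Polynomial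

/-- The integers `-N, …, N`. -/
noncomputable def symIcc (N : ℕ) : Finset ℤ := Finset.Icc (-(N : ℤ)) N

theorem card_symIcc (N : ℕ) : (symIcc N).card = 2 * N + 1 := by
  simp [symIcc]; omega

theorem neg_mem_symIcc {N : ℕ} {j : ℤ} (hj : j ∈ symIcc N) : -j ∈ symIcc N := by
  simp only [symIcc, Finset.mem_Icc] at *; omega

/-- The polynomial `∏_{|j| ≤ N} (X + j)`. -/
noncomputable def centralPoly (N : ℕ) : ℚ[X] := ∏ j ∈ symIcc N, (X + C (j : ℚ))

/-- The polynomial `centralPoly N ^ B / (X + j) ^ b`. -/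
noncomputable def cofactor (N B b : ℕ) (j : ℤ) : ℚ[X] :=
  (X + C (j : ℚ)) ^ (B - b) * ∏ i ∈ (symIcc N).erase j, (X + C (i : ℚ)) ^ B

theorem cofactor_mul {N B b : ℕ} {j : ℤ} (hb : b ≤ B) (hj : j ∈ symIcc N) :
    (X + C (j : ℚ)) ^ b * cofactor N B b j = centralPoly N ^ B := by
  rw [cofactor, ← mul_assoc, ← pow_add, Nat.add_sub_cancel' hb, Finset.prod_pow, ← mul_pow,
    Finset.mul_prod_erase (symIcc N) (fun i => X + C (i : ℚ)) hj, centralPoly]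

theorem monic_cofactor (N B b : ℕ) (j : ℤ) : (cofactor N B b j).Monic :=
  ((monic_X_add_C _).pow _).mul (monic_prod_of_monic _ _ fun _ _ => (monic_X_add_C _).pow _)

theorem monic_centralPoly (N : ℕ) : (centralPoly N).Monic :=
  monic_prod_of_monic _ _ fun _ _ => monic_X_add_C _

theorem natDegree_centralPoly (N : ℕ) : (centralPoly N).natDegree = 2 * N + 1 := by
  rw [centralPoly, natDegree_prod_of_monic _ _ fun _ _ => monic_X_add_C _]
  simp only [natDegree_X_add_C, Finset.sum_const, card_symIcc, smul_eq_mul, mul_one]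

theorem natDegree_cofactor {N B b : ℕ} {j : ℤ} (hb : b ≤ B) (hj : j ∈ symIcc N) :
    (cofactor N B b j).natDegree + b = B * (2 * N + 1) := by
  have h := congrArg natDegree (cofactor_mul hb hj)
  rw [((monic_X_add_C _).pow _).natDegree_mul (monic_cofactor N B b j),
    (monic_X_add_C _).natDegree_pow, (monic_centralPoly N).natDegree_pow,
    natDegree_centralPoly, natDegree_X_add_C] at h
  omega

theorem centralPoly_comp_neg (N : ℕ) : (centralPoly N).comp (-X) = -centralPoly N := by
  have h1 : (centralPoly N).comp (-X) = ∏ j ∈ symIcc N, -(X + C ((-j : ℤ) : ℚ)) := by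
    rw [centralPoly, prod_comp]
    refine Finset.prod_congr rfl fun j _ => ?_
    simp [add_comm]
  rw [h1, Finset.prod_neg, card_symIcc, centralPoly]
  have : ∏ j ∈ symIcc N, (X + C ((-j : ℤ) : ℚ)) = ∏ j ∈ symIcc N, (X + C (j : ℚ)) :=
    Finset.prod_nbij' (fun j => -j) (fun j => -j) (fun _ => neg_mem_symIcc)
      (fun _ => neg_mem_symIcc) (by simp) (by simp) (by simp)
  rw [this]
  simp [pow_add, pow_mul]

/-- `centralPoly` is odd, so x ↦ -x exchanges the poles attached to j and -j, up to sign. -/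
theorem cofactor_comp_neg {N B b : ℕ} {j : ℤ} (hb : b ≤ B) (hj : j ∈ symIcc N) :
    (cofactor N B b j).comp (-X) = (-1) ^ (B + b) * cofactor N B b (-j) := by
  have h1 := congrArg (fun p => p.comp (-X)) (cofactor_mul hb hj)
  have h2 := cofactor_mul hb (neg_mem_symIcc hj)
  have hne : (X + C ((-j : ℤ) : ℚ)) ^ b ≠ 0 := ((monic_X_add_C _).pow _).ne_zero
  have hj' : (-X + C (j : ℚ) : ℚ[X]) = -(X + C ((-j : ℤ) : ℚ)) := by simp [add_comm]
  simp only [mul_comp, pow_comp, add_comp, X_comp, C_comp, centralPoly_comp_neg] at h1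
  rw [hj', neg_pow, neg_pow (centralPoly N), ← h2] at h1
  refine mul_left_cancel₀ hne ?_
  have h3 : ((-1 : ℚ[X]) ^ b) * (-1) ^ b = 1 := by rw [← mul_pow]; simp
  calc (X + C ((-j : ℤ) : ℚ)) ^ b * (cofactor N B b j).comp (-X)
      = (-1) ^ b * ((-1) ^ b * (X + C ((-j : ℤ) : ℚ)) ^ b * (cofactor N B b j).comp (-X)) := by
        linear_combination
          (-(X + C ((-j : ℤ) : ℚ)) ^ b * (cofactor N B b j).comp (-X)) * h3
    _ = _ := by rw [h1, pow_add]; ring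

theorem exists_partialFractions (N B : ℕ) (Q : ℚ[X]) (hQ : Q.natDegree < B * (2 * N + 1)) :
    ∃ c : ℤ → ℕ → ℚ,
      Q = ∑ j ∈ symIcc N, ∑ b ∈ Finset.range B, c j b • cofactor N B (b + 1) j := by
  obtain ⟨q, r, hr, h⟩ := eq_quo_mul_prod_pow_add_sum_rem_mul_prod_pow (s := symIcc N) Q
    (g := fun j : ℤ => X + C (j : ℚ)) (fun j _ => monic_X_add_C _)
    (fun i _ j _ hij => by
      have := isCoprime_X_sub_C_of_isUnit_sub (R := ℚ) (a := -(i : ℚ)) (b := -(j : ℚ))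
        (by rw [isUnit_iff_ne_zero]; intro h; apply hij
            have : (i : ℚ) = j := by linarith
            exact_mod_cast this)
      simpa using this) fun _ => B
  have hr' : ∀ i ∈ symIcc N, ∀ j, r i j = C ((r i j).coeff 0) := fun i hi j => by
    refine eq_C_of_degree_le_zero ?_
    have := hr i hi j
    rw [degree_X_add_C] at this
    exact Order.le_of_lt_succ this
  -- The remainders are indexed by the power of X + j left in the numerator; a pole of order b + 1
  -- leaves the power B - 1 - b.
  let c : ℤ → ℕ → ℚ := fun j b => if hb : B - 1 - b < B then (r j ⟨B - 1 - b, hb⟩).coeff 0 else 0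
  have hsum : ∑ i ∈ symIcc N, ∑ j, r i j * (X + C (i : ℚ)) ^ j.1 *
      ∏ k ∈ (symIcc N).erase i, (X + C (k : ℚ)) ^ B =
      ∑ j ∈ symIcc N, ∑ b ∈ Finset.range B, c j b • cofactor N B (b + 1) j := by
    refine Finset.sum_congr rfl fun i hi => ?_
    rw [← Finset.sum_range_reflect, ← Fin.sum_univ_eq_sum_range
      (fun b => c i (B - 1 - b) • cofactor N B (B - 1 - b + 1) i)]
    refine Finset.sum_congr rfl fun j _ => ?_
    have hj := j.2
    have e1 : B - 1 - (B - 1 - (j : ℕ)) = j := by omega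
    have e2 : B - (B - 1 - (j : ℕ) + 1) = j := by omega
    have e3 : c i (B - 1 - j) = (r i j).coeff 0 := by simp [c, e1]
    rw [e3, cofactor, e2, smul_eq_C_mul, ← hr' i hi j, mul_assoc]
  rw [hsum] at h
  refine ⟨c, ?_⟩
  set T := ∑ j ∈ symIcc N, ∑ b ∈ Finset.range B, c j b • cofactor N B (b + 1) j with hT
  have hTdeg : T.degree < ((B * (2 * N + 1) : ℕ) : WithBot ℕ) := by
    have : T ∈ degreeLT ℚ (B * (2 * N + 1)) := by
      refine Submodule.sum_mem _ fun j hj => Submodule.sum_mem _ fun b hb =>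
        Submodule.smul_mem _ _ ?_
      rw [mem_degreeLT, degree_eq_natDegree (monic_cofactor _ _ _ _).ne_zero]
      have := natDegree_cofactor (N := N) (j := j)
        (show b + 1 ≤ B from Finset.mem_range.1 hb) hj
      exact_mod_cast (by omega)
    exact mem_degreeLT.1 this
  have hQdeg : Q.degree < ((B * (2 * N + 1) : ℕ) : WithBot ℕ) :=
    degree_le_natDegree.trans_lt (by exact_mod_cast hQ)
  have hmon : (∏ i ∈ symIcc N, (X + C (i : ℚ)) ^ B).Monic :=
    monic_prod_of_monic _ _ fun _ _ => (monic_X_add_C _).pow _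
  have hmdeg : (∏ i ∈ symIcc N, (X + C (i : ℚ)) ^ B).degree =
      ((B * (2 * N + 1) : ℕ) : WithBot ℕ) := by
    rw [degree_eq_natDegree hmon.ne_zero, Finset.prod_pow, ← centralPoly,
      (monic_centralPoly N).natDegree_pow, natDegree_centralPoly]
  -- The polynomial part vanishes because `Q` and `T` both have degree below that of the
  -- denominator.
  have hq : q = 0 := by
    by_contra hq
    refine hmon.not_dvd_of_degree_lt (q := Q - T) ?_ ?_ ⟨q, ?_⟩
    · intro h0
      have : q * ∏ i ∈ symIcc N, (X + C (i : ℚ)) ^ B = 0 := by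
        linear_combination h0 - h
      exact mul_ne_zero hq hmon.ne_zero this
    · rw [hmdeg]
      exact (degree_sub_le _ _).trans_lt (max_lt hQdeg hTdeg)
    · linear_combination h
  rw [h, hq]; simp

/-- In this degree only simple poles contribute, so the coefficient reads off the sum of the
residues. -/
theorem coeff_cofactor {N B b : ℕ} {j : ℤ} (hb : b + 1 ≤ B) (hj : j ∈ symIcc N) :
    (cofactor N B (b + 1) j).coeff (B * (2 * N + 1) - 1) = if b = 0 then 1 else 0 := by
  have hd := natDegree_cofactor hb hj
  split_ifs with h0
  · subst h0
    rw [show B * (2 * N + 1) - 1 = (cofactor N B (0 + 1) j).natDegree by omega]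
    exact monic_cofactor _ _ _ _
  · exact coeff_eq_zero_of_natDegree_lt (by omega)

/-- The function `Q / centralPoly N ^ B`, truncated to `x > N`. -/
noncomputable def ratioFun (N B : ℕ) (Q : ℚ[X]) (x : ℕ) : ℝ :=
  if N < x then aeval (x : ℝ) Q / aeval (x : ℝ) (centralPoly N) ^ B else 0

theorem cast_add_pos {N x : ℕ} {j : ℤ} (hx : N < x) (hj : j ∈ symIcc N) :
    (0 : ℝ) < (x : ℝ) + j := by
  simp only [symIcc, Finset.mem_Icc] at hj
  have : (0 : ℤ) < x + j := by omega
  exact_mod_cast this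

theorem aeval_centralPoly_ne_zero {N x : ℕ} (hx : N < x) :
    aeval (x : ℝ) (centralPoly N) ≠ 0 := by
  rw [centralPoly, map_prod]
  refine Finset.prod_ne_zero_iff.2 fun j hj => ?_
  simpa using (cast_add_pos hx hj).ne'

theorem aeval_cofactor_div {N B b x : ℕ} {j : ℤ} (hx : N < x) (hb : b ≤ B) (hj : j ∈ symIcc N) :
    aeval (x : ℝ) (cofactor N B b j) / aeval (x : ℝ) (centralPoly N) ^ B =
      1 / ((x : ℝ) + j) ^ b := by
  have h := congrArg (aeval (x : ℝ)) (cofactor_mul hb hj)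
  simp only [map_mul, map_pow, map_add, aeval_X, aeval_C] at h
  rw [div_eq_div_iff (pow_ne_zero _ (aeval_centralPoly_ne_zero hx))
    (pow_ne_zero _ (cast_add_pos hx hj).ne'), ← h]
  simp; ring

/-- The function `1 / x ^ b`, truncated to `x > N`. -/
noncomputable def truncPow (N b : ℕ) (x : ℕ) : ℝ := if N < x then 1 / (x : ℝ) ^ b else 0

/-- The function `1 / (x + j) ^ b - (-1) ^ b / (x - j) ^ b`, truncated to `x > N`. -/
noncomputable def oddShift (N b : ℕ) (j : ℤ) (x : ℕ) : ℝ :=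
  if N < x then 1 / ((x : ℝ) + j) ^ b - (-1) ^ b * (1 / ((x : ℝ) - j) ^ b) else 0

/-- The difference of `oddShift` at `i + 1` and at `i`. -/
noncomputable def oddDiff (N b i : ℕ) : ℕ → ℝ := oddShift N b (i + 1) - oddShift N b i

theorem oddShift_zero (N b : ℕ) : oddShift N b 0 = (1 - (-1) ^ b : ℚ) • truncPow N b := by
  funext x
  simp only [oddShift, truncPow, Pi.smul_apply, Rat.smul_def]
  split_ifs <;> simp; ring

theorem oddShift_neg (N b : ℕ) (j : ℤ) :
    oddShift N b (-j) = (-(-1) ^ b : ℚ) • oddShift N b j := by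
  funext x
  have h3 : ((-1 : ℝ) ^ b) * (-1) ^ b = 1 := by rw [← mul_pow]; simp
  simp only [oddShift, Pi.smul_apply, Rat.smul_def]
  split_ifs
  · push_cast
    rw [sub_neg_eq_add, ← sub_eq_add_neg]
    linear_combination (-(1 / ((x : ℝ) - j) ^ b)) * h3
  · simp

/-- The functions `oddDiff`, with exponents at most `B`. -/
def oddDiffs (N B : ℕ) : Set (ℕ → ℝ) :=
  {f | ∃ a i : ℕ, 1 ≤ a ∧ a ≤ B ∧ i < N ∧ f = oddDiff N a i}

/-- Walking from shift 0 to j in unit steps adds one `oddDiff` each time; negative shifts reduce to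
positive ones by `oddShift_neg`. -/
theorem oddShift_sub_mem {N B b : ℕ} (hb : 1 ≤ b) (hbB : b ≤ B) {j : ℤ} (hj : j ∈ symIcc N) :
    oddShift N b j - (1 - (-1) ^ b : ℚ) • truncPow N b ∈ Submodule.span ℚ (oddDiffs N B) := by
  have hnat : ∀ i : ℕ, i ≤ N →
      oddShift N b i - (1 - (-1) ^ b : ℚ) • truncPow N b ∈ Submodule.span ℚ (oddDiffs N B) := by
    intro i
    induction i with
    | zero => intro _; simp [oddShift_zero]
    | succ i ih =>
      intro hi
      have := add_mem (ih (by omega))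
        (Submodule.subset_span ⟨b, i, hb, hbB, by omega, rfl⟩ :
          oddDiff N b i ∈ Submodule.span ℚ (oddDiffs N B))
      convert this using 1
      rw [oddDiff]; push_cast; abel
  simp only [symIcc, Finset.mem_Icc] at hj
  obtain ⟨i, rfl | rfl⟩ := j.eq_nat_or_neg
  · exact hnat i (by omega)
  · have := Submodule.smul_mem _ (-(-1) ^ b : ℚ) (hnat i (by omega))
    convert this using 1
    have h3 : ((-1 : ℚ) ^ b) * (-1) ^ b = 1 := by rw [← mul_pow]; simp
    rw [oddShift_neg, smul_sub, smul_smul]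
    congr 2
    linear_combination -h3

/-- The functions `1 / x ^ b`, truncated to `x > N`, with `3 ≤ b ≤ B` odd. -/
def truncPows (N B : ℕ) : Set (ℕ → ℝ) :=
  {f | ∃ b : ℕ, Odd b ∧ 3 ≤ b ∧ b ≤ B ∧ f = truncPow N b}

/-- Averaging the partial fractions with their reflection gives a combination of `oddShift`; moving
each pole to 0 costs elements of `oddDiffs`. At 0 the factor 1 - (-1)^b removes even b, and b = 1
disappears with the sum of residues. -/
theorem ratioFun_mem_span (N B : ℕ) (Q : ℚ[X]) (hdeg : Q.natDegree + 2 ≤ B * (2 * N + 1))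
    (hodd : Q.comp (-X) = (-1) ^ (B + 1) * Q) :
    ratioFun N B Q ∈ Submodule.span ℚ (oddDiffs N B ∪ truncPows N B) := by
  obtain ⟨c, hc⟩ := exists_partialFractions N B Q (by omega)
  have hB : 0 < B := by
    rcases Nat.eq_zero_or_pos B with rfl | h
    · simp at hdeg
    · exact h
  -- This is where degree at most -2 is needed: the coefficient just below the degree of the
  -- denominator vanishes in `Q`.
  have hres : ∑ j ∈ symIcc N, c j 0 = 0 := by
    have h := congrArg (fun p => p.coeff (B * (2 * N + 1) - 1)) hc
    simp only [finsetSum_coeff, coeff_smul, smul_eq_mul] at h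
    rw [coeff_eq_zero_of_natDegree_lt (by omega)] at h
    rw [h]
    refine Finset.sum_congr rfl fun j hj => ?_
    rw [Finset.sum_eq_single_of_mem 0 (Finset.mem_range.2 hB)]
    · rw [coeff_cofactor hB hj]; simp
    · intro b hb hb0
      rw [coeff_cofactor (Finset.mem_range.1 hb) hj]; simp [hb0]
  have h3 : ∀ n : ℕ, ((-1 : ℚ[X]) ^ n) * (-1) ^ n = 1 := fun n => by rw [← mul_pow]; simp
  have h2Q : 2 * Q = ∑ j ∈ symIcc N, ∑ b ∈ Finset.range B,
      c j b • (cofactor N B (b + 1) j - (-1) ^ (b + 1) * cofactor N B (b + 1) (-j)) := by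
    have e : Q = (-1) ^ (B + 1) * Q.comp (-X) := by
      rw [hodd, ← mul_assoc, h3, one_mul]
    rw [two_mul]
    nth_rewrite 2 [e]
    rw [hc]
    simp only [sum_comp, smul_comp, Finset.mul_sum, ← Finset.sum_add_distrib]
    refine Finset.sum_congr rfl fun j hj => Finset.sum_congr rfl fun b hb => ?_
    rw [cofactor_comp_neg (Finset.mem_range.1 hb) hj, mul_smul_comm, ← smul_add]
    congr 1
    rw [pow_add (-1 : ℚ[X]) B (b + 1), pow_succ (-1 : ℚ[X]) B]
    linear_combination (-(-1) ^ (b + 1) * cofactor N B (b + 1) (-j)) * h3 B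
  have hfun : (2 : ℚ) • ratioFun N B Q = ∑ j ∈ symIcc N, ∑ b ∈ Finset.range B,
      c j b • oddShift N (b + 1) j := by
    funext x
    simp only [Pi.smul_apply, Finset.sum_apply, Rat.smul_def]
    by_cases hx : N < x
    · have h := congrArg (aeval (x : ℝ)) h2Q
      simp only [map_mul, map_sum, map_smul, map_sub, map_pow, map_neg, map_one,
        map_ofNat] at h
      simp only [ratioFun, oddShift, if_pos hx]
      push_cast
      rw [← mul_div_assoc, h, Finset.sum_div]
      refine Finset.sum_congr rfl fun j hj => ?_
      rw [Finset.sum_div]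
      refine Finset.sum_congr rfl fun b hb => ?_
      rw [Rat.smul_def, mul_div_assoc, sub_div, mul_div_assoc,
        aeval_cofactor_div hx (Finset.mem_range.1 hb) hj,
        aeval_cofactor_div hx (Finset.mem_range.1 hb) (neg_mem_symIcc hj)]
      push_cast
      rw [← sub_eq_add_neg]
    · simp [ratioFun, oddShift, hx]
  have hsplit : (2 : ℚ) • ratioFun N B Q =
      (∑ j ∈ symIcc N, ∑ b ∈ Finset.range B, c j b •
        (oddShift N (b + 1) j - (1 - (-1) ^ (b + 1) : ℚ) • truncPow N (b + 1))) +
      ∑ b ∈ Finset.range B, ((∑ j ∈ symIcc N, c j b) * (1 - (-1) ^ (b + 1))) •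
        truncPow N (b + 1) := by
    rw [hfun]
    simp only [Finset.sum_mul, Finset.sum_smul]
    rw [Finset.sum_comm (s := Finset.range B), ← Finset.sum_add_distrib]
    refine Finset.sum_congr rfl fun j _ => ?_
    rw [← Finset.sum_add_distrib]
    refine Finset.sum_congr rfl fun b _ => ?_
    rw [smul_sub, smul_smul, sub_add_cancel]
  have hmem : (2 : ℚ) • ratioFun N B Q ∈
      Submodule.span ℚ (oddDiffs N B ∪ truncPows N B) := by
    rw [hsplit]
    refine add_mem (Submodule.sum_mem _ fun j hj => Submodule.sum_mem _ fun b hb =>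
      Submodule.smul_mem _ _ (Submodule.span_mono Set.subset_union_left
        (oddShift_sub_mem (by omega) (Finset.mem_range.1 hb) hj)))
      (Submodule.sum_mem _ fun b hb => ?_)
    rcases Nat.even_or_odd (b + 1) with he | ho
    · simp [he.neg_one_pow]
    · by_cases hb0 : b = 0
      · subst hb0; simp [hres]
      · refine Submodule.smul_mem _ _ (Submodule.subset_span (Or.inr ⟨b + 1, ho, ?_,
          Finset.mem_range.1 hb, rfl⟩))
        rcases ho with ⟨t, ht⟩
        omega
  have := Submodule.smul_mem _ (1 / 2 : ℚ) hmem
  rwa [smul_smul, show (1 / 2 : ℚ) * 2 = 1 by norm_num, one_smul] at this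

end PartialFractions

/-! ### Sums of one-variable functions. -/

section Sums

open Polynomial Filter Topology

theorem hasSum_of_eq {f g : ℕ → ℝ} {S : ℝ} (h : HasSum f S) (e : ∀ x, f x = g x) : HasSum g S :=
  funext e ▸ h

theorem hasSum_telescope {u : ℕ → ℝ} (hu : Antitone u) (h0 : Tendsto u atTop (𝓝 0)) :
    HasSum (fun x => u x - u (x + 1)) (u 0) := by
  rw [hasSum_iff_tendsto_nat_of_nonneg fun x => sub_nonneg.2 (hu x.le_succ)]
  simp only [Finset.sum_range_sub']
  simpa using (tendsto_const_nhds (x := u 0)).sub h0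

/-- The function `1 / (x + c) ^ a`, made constant for `x ≤ N + 1`. -/
noncomputable def clampedPow (N a : ℕ) (c : ℤ) (x : ℕ) : ℝ :=
  1 / (((max x (N + 1) : ℕ) : ℝ) + c) ^ a

theorem clampedPow_of_lt {N a x : ℕ} {c : ℤ} (hx : N < x) :
    clampedPow N a c x = 1 / ((x : ℝ) + c) ^ a := by
  rw [clampedPow, max_eq_left (by omega)]

theorem clampedPow_rational (N a : ℕ) (c : ℤ) (x : ℕ) :
    ∃ r : ℚ, clampedPow N a c x = r :=
  ⟨1 / (((max x (N + 1) : ℕ) : ℚ) + c) ^ a, by simp only [clampedPow]; push_cast; rfl⟩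

theorem antitone_clampedPow (N a : ℕ) {c : ℤ} (hc : c ∈ symIcc N) :
    Antitone (clampedPow N a c) := by
  intro x y hxy
  have hpos : (0 : ℝ) < ((max x (N + 1) : ℕ) : ℝ) + c := cast_add_pos (by omega) hc
  refine one_div_le_one_div_of_le (pow_pos hpos a) (pow_le_pow_left₀ hpos.le ?_ a)
  have : ((max x (N + 1) : ℕ) : ℝ) ≤ ((max y (N + 1) : ℕ) : ℝ) := by
    exact_mod_cast max_le_max hxy le_rfl
  linarith

theorem tendsto_clampedPow (N : ℕ) {a : ℕ} (ha : 1 ≤ a) (c : ℤ) :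
    Tendsto (clampedPow N a c) atTop (𝓝 0) := by
  have h1 : Tendsto (fun x : ℕ => (x : ℝ) + c) atTop atTop :=
    tendsto_atTop_add_const_right _ _ tendsto_natCast_atTop_atTop
  have h2 := ((tendsto_pow_atTop (by omega : a ≠ 0)).comp h1).inv_tendsto_atTop
  refine h2.congr' ?_
  filter_upwards [eventually_gt_atTop N] with x hx
  rw [clampedPow_of_lt hx]
  simp

/-- The constant extension of `clampedPow` makes the telescoping terms vanish for x ≤ N, in
agreement with the truncation of `oddShift`. -/
theorem oddDiff_eq (N a i : ℕ) (x : ℕ) : oddDiff N a i x =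
    -(clampedPow N a i x - clampedPow N a i (x + 1)) -
      (-1) ^ a * (clampedPow N a (-(i + 1)) x - clampedPow N a (-(i + 1)) (x + 1)) := by
  simp only [oddDiff, Pi.sub_apply, oddShift]
  by_cases hx : N < x
  · rw [clampedPow_of_lt hx, clampedPow_of_lt hx, clampedPow_of_lt (by omega),
      clampedPow_of_lt (by omega)]
    simp only [if_pos hx]
    push_cast
    ring_nf
  · have h : ∀ c, clampedPow N a c x = clampedPow N a c (x + 1) := fun c => by
      rw [clampedPow, clampedPow, max_eq_right (by omega), max_eq_right (by omega)]
    simp [hx, h]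

theorem hasSum_oddDiff {N a i : ℕ} (ha : 1 ≤ a) (hi : i < N) :
    HasSum (fun x => oddDiff N a i (x + 1))
      (-clampedPow N a i 1 - (-1) ^ a * clampedPow N a (-(i + 1)) 1) := by
  have key : ∀ c ∈ symIcc N, HasSum (fun x => clampedPow N a c (x + 1) -
      clampedPow N a c (x + 1 + 1)) (clampedPow N a c 1) := fun c hc =>
    hasSum_telescope (u := fun x => clampedPow N a c (x + 1))
      (fun x y hxy => antitone_clampedPow N a hc (by omega))
      ((tendsto_add_atTop_iff_nat 1).2 (tendsto_clampedPow N ha c))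
  simp only [oddDiff_eq]
  exact (key i (by simp [symIcc]; omega)).neg.sub
    ((key (-(i + 1)) (by simp [symIcc]; omega)).mul_left _)

theorem hasSum_one_div_pow {b : ℕ} (hb : 2 ≤ b) :
    HasSum (fun x : ℕ => 1 / ((x + 1 : ℕ) : ℝ) ^ b) (riemannZeta (b : ℂ)).re := by
  have h1 : HasSum (fun x : ℕ => 1 / (x : ℝ) ^ b) (riemannZeta (b : ℂ)).re := by
    have hs := (Real.summable_one_div_nat_pow.2 (show 1 < b by omega)).hasSum
    convert hs
    rw [zeta_nat_eq_tsum_of_gt_one (by omega)]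
    rw [show (∑' n : ℕ, 1 / (n : ℂ) ^ b) = ((∑' n : ℕ, 1 / (n : ℝ) ^ b : ℝ) : ℂ) by
      push_cast; rfl]
    simp
  have h2 := (hasSum_nat_add_iff' 1).2 h1
  simpa [show b ≠ 0 by omega] using h2

theorem hasSum_ite_lt (N : ℕ) (f : ℕ → ℝ) :
    HasSum (fun x => if x < N then f x else 0) (∑ x ∈ Finset.range N, f x) := by
  have h : HasSum (fun x => if x < N then f x else 0)
      (∑ x ∈ Finset.range N, if x < N then f x else 0) :=
    hasSum_sum_of_ne_finset_zero fun x hx => by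
      simp only [Finset.mem_range] at hx
      simp [hx]
  rwa [Finset.sum_congr rfl fun x hx => if_pos (Finset.mem_range.1 hx)] at h

theorem sum_rational {f : ℕ → ℝ} (hf : ∀ x, ∃ r : ℚ, f x = r) (s : Finset ℕ) :
    ∃ r : ℚ, ∑ x ∈ s, f x = r := by
  choose r hr using hf
  exact ⟨∑ x ∈ s, r x, by simp [hr]⟩

theorem zeta_mem_oddZetaSpan {b B : ℕ} (h : Odd b) (h3 : 3 ≤ b) (hB : b ≤ B) :
    (riemannZeta (b : ℂ)).re ∈ oddZetaSpan B :=
  Submodule.subset_span (Or.inr ⟨b, h, h3, hB, rfl⟩)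

theorem hasSum_truncPow (N : ℕ) {b : ℕ} (hb : 2 ≤ b) :
    ∃ r : ℚ, HasSum (fun x => truncPow N b (x + 1)) ((riemannZeta (b : ℂ)).re - r) := by
  obtain ⟨r, hr⟩ := sum_rational (f := fun x : ℕ => 1 / ((x + 1 : ℕ) : ℝ) ^ b)
    (fun x => ⟨1 / ((x + 1 : ℕ) : ℚ) ^ b, by push_cast; rfl⟩) (Finset.range N)
  refine ⟨r, ?_⟩
  have h := (hasSum_one_div_pow hb).sub
    (hasSum_ite_lt N fun x : ℕ => 1 / ((x + 1 : ℕ) : ℝ) ^ b)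
  rw [hr] at h
  refine hasSum_of_eq h fun x => ?_
  by_cases hx : N < x + 1
  · simp [truncPow, hx, show ¬ x < N by omega]
  · simp [truncPow, hx, show x < N by omega]

theorem exists_hasSum_of_mem_span {N B : ℕ} {f : ℕ → ℝ}
    (hf : f ∈ Submodule.span ℚ (oddDiffs N B ∪ truncPows N B)) :
    ∃ S ∈ oddZetaSpan B, HasSum (fun x => f (x + 1)) S := by
  induction hf using Submodule.span_induction with
  | zero => exact ⟨0, Submodule.zero_mem _, hasSum_zero⟩
  | add f g _ _ hf hg =>
    obtain ⟨S, hS, h⟩ := hf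
    obtain ⟨S', hS', h'⟩ := hg
    exact ⟨S + S', add_mem hS hS', h.add h'⟩
  | smul r f _ hf =>
    obtain ⟨S, hS, h⟩ := hf
    exact ⟨r • S, Submodule.smul_mem _ r hS, h.const_smul r⟩
  | mem f hf =>
    rcases hf with ⟨a, i, ha, -, hi, rfl⟩ | ⟨b, hb, hb3, hbB, rfl⟩
    · refine ⟨_, ?_, hasSum_oddDiff ha hi⟩
      obtain ⟨r, hr⟩ := clampedPow_rational N a i 1
      obtain ⟨r', hr'⟩ := clampedPow_rational N a (-(i + 1)) 1
      rw [hr, hr']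
      exact_mod_cast ratCast_mem_oddZetaSpan B (-r - (-1) ^ a * r')
    · obtain ⟨r, hr⟩ := hasSum_truncPow N (b := b) (by omega)
      exact ⟨_, sub_mem (zeta_mem_oddZetaSpan hb hb3 hbB) (ratCast_mem_oddZetaSpan B r), hr⟩

theorem oddZetaSpan_two_mul (A : ℕ) : oddZetaSpan (2 * A) ≤ oddZetaSpan (2 * A - 1) := by
  refine Submodule.span_mono (Set.insert_subset_insert ?_)
  rintro x ⟨s, ⟨t, ht⟩, h3, hs, rfl⟩
  exact ⟨s, ⟨t, ht⟩, h3, by omega, rfl⟩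

end Sums

/-! ### The contraction coefficients are odd zeta values. -/

section Pairing

open Polynomial Filter Topology

/-- Differences `h x - h (x + 1)` of a rational-valued `h` tending to `0` such that
`h x + h (x + 1)` is an even rational function for `x > N`. -/
def IsEvenDifference (N A : ℕ) (g : ℕ → ℝ) : Prop :=
  ∃ h : ℕ → ℝ, (∀ x, ∃ r : ℚ, h x = r) ∧ Tendsto h atTop (𝓝 0) ∧
    (∀ x, g (x + 1) = h (x + 1) - h (x + 2)) ∧
    ∃ Q : ℚ[X], Q.natDegree + 1 ≤ A * (2 * N + 1) ∧ Q.comp (-X) = (-1) ^ A * Q ∧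
      ∀ x, N < x → h x + h (x + 1) = ratioFun N A Q x

/-- Rational-valued functions which are odd rational functions for `x > N`. -/
def IsOddRatio (N A : ℕ) (f : ℕ → ℝ) : Prop :=
  (∀ x, ∃ r : ℚ, f x = r) ∧
    ∃ Q : ℚ[X], Q.natDegree + 1 ≤ A * (2 * N + 1) ∧ Q.comp (-X) = (-1) ^ (A + 1) * Q ∧
      ∀ x, N < x → f x = ratioFun N A Q x

variable {F : Type*} (ev : F → ℕ → ℝ)

theorem partialSum_of_difference {g : F} {h : ℕ → ℝ}
    (hg : ∀ x, ev g (x + 1) = h (x + 1) - h (x + 2)) (M : ℕ) :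
    partialSum ev g M = h 1 - h (M + 1) := by
  simp only [partialSum, hg]
  exact Finset.sum_range_sub' (fun x => h (x + 1)) M

theorem tsum_rational (hev : ∀ f, Summable (ev f)) {N A : ℕ} {g : F}
    (hg : IsEvenDifference N A (ev g)) : ∃ r : ℚ, ∑' x, ev g (x + 1) = r := by
  obtain ⟨h, hr, h0, hd, -⟩ := hg
  obtain ⟨r, hr⟩ := hr 1
  refine ⟨r, tendsto_nhds_unique (tendsto_partialSum ev hev g) ?_⟩
  simp only [funext (partialSum_of_difference ev hd), hr]
  simpa using (tendsto_const_nhds (x := (r : ℝ))).sub ((tendsto_add_atTop_iff_nat 1).2 h0)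

/-- The pairing splits into 2h(1) ∑ f and a sum of (even) · (odd) functions. The latter product is
odd, with denominator power 2A and degree at most -2, so `ratioFun_mem_span` applies; no odd s
equals 2A, whence the bound 2A - 1. -/
theorem infPairing_mem {N A : ℕ} {g f : F} (hg : IsEvenDifference N A (ev g))
    (hf : IsOddRatio N A (ev f))
    (hsum : ∃ S ∈ oddZetaSpan (2 * A - 1), HasSum (fun x => ev f (x + 1)) S) :
    infPairing ev g f ∈ oddZetaSpan (2 * A - 1) := by
  obtain ⟨h, hr, -, hd, Q, hQdeg, hQ, hhQ⟩ := hg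
  obtain ⟨hfr, Q', hQ'deg, hQ', hfQ⟩ := hf
  obtain ⟨S, hS, hfS⟩ := hsum
  have hprod : ratioFun N (2 * A) (Q * Q') ∈
      Submodule.span ℚ (oddDiffs N (2 * A) ∪ truncPows N (2 * A)) := by
    refine ratioFun_mem_span _ _ _ ?_ ?_
    · have := natDegree_mul_le (p := Q) (q := Q')
      rw [mul_assoc]
      omega
    · rw [mul_comp, hQ, hQ']; ring
  obtain ⟨T, hT, hTsum⟩ := exists_hasSum_of_mem_span hprod
  have hφr : ∀ x, ∃ r : ℚ, (h (x + 1) + h (x + 2)) * ev f (x + 1) = r := fun x => by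
    obtain ⟨a, ha⟩ := hr (x + 1)
    obtain ⟨b, hb⟩ := hr (x + 2)
    obtain ⟨c, hc⟩ := hfr (x + 1)
    exact ⟨(a + b) * c, by rw [ha, hb, hc]; push_cast; rfl⟩
  -- `ρ` collects the finitely many arguments x + 1 ≤ N, where the rational-function formula is not
  -- available.
  obtain ⟨ρ, hρ⟩ := sum_rational hφr (Finset.range N)
  have hφ : HasSum (fun x => (h (x + 1) + h (x + 2)) * ev f (x + 1)) (T + ρ) := by
    have := hTsum.add (hasSum_ite_lt N fun x => (h (x + 1) + h (x + 2)) * ev f (x + 1))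
    rw [hρ] at this
    convert this using 1
    funext x
    by_cases hx : x < N
    · simp [ratioFun, hx, show ¬ N < x + 1 by omega]
    · have hx' : N < x + 1 := by omega
      rw [hhQ _ hx', hfQ _ hx', if_neg hx, add_zero]
      simp only [ratioFun, if_pos hx', map_mul]
      rw [two_mul, pow_add, div_mul_div_comm]
  obtain ⟨r₁, hr₁⟩ := hr 1
  have htot : HasSum (fun x => (partialSum ev g (x + 1) + partialSum ev g x) * ev f (x + 1))
      (((2 * r₁ : ℚ) : ℝ) * S - (T + ρ)) := by
    refine hasSum_of_eq ((hfS.mul_left ((2 * r₁ : ℚ) : ℝ)).sub hφ) fun x => ?_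
    rw [partialSum_of_difference ev hd, partialSum_of_difference ev hd, hr₁]
    push_cast
    ring
  rw [infPairing, htot.tsum_eq]
  exact neg_mem (sub_mem (ratCast_mul_mem _ hS)
    (add_mem (oddZetaSpan_two_mul A hT) (ratCast_mem_oddZetaSpan _ ρ)))

end Pairing

/-! ### Differences and pure powers as generators. -/

section Generators

open Polynomial Filter Topology

/-- The functions `oddDiff` and the indicator functions of the integers `1, …, N`. -/
def diffGens (N A : ℕ) : Set (ℕ → ℝ) :=
  oddDiffs N A ∪ {f | ∃ i, 1 ≤ i ∧ i ≤ N ∧ f = Pi.single i 1}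

/-- The functions `1 / x ^ a` with `3 ≤ a ≤ A` odd. -/
def powGens (A : ℕ) : Set (ℕ → ℝ) :=
  {f | ∃ a : ℕ, Odd a ∧ 3 ≤ a ∧ a ≤ A ∧ f = fun x : ℕ => 1 / (x : ℝ) ^ a}

theorem neg_one_pow_mul_self_poly (n : ℕ) : ((-1 : ℚ[X]) ^ n) * (-1) ^ n = 1 := by
  rw [← mul_pow]; simp

theorem natDegree_cofactor_add_one_le {N A a : ℕ} (ha : 1 ≤ a) (haA : a ≤ A) {j : ℤ}
    (hj : j ∈ symIcc N) : (cofactor N A a j).natDegree + 1 ≤ A * (2 * N + 1) := by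
  have := natDegree_cofactor haA hj
  omega

theorem natDegree_neg_one_pow_mul_le (n : ℕ) (Q : ℚ[X]) :
    ((-1) ^ n * Q).natDegree ≤ Q.natDegree := by
  rcases neg_one_pow_eq_or ℚ[X] n with h | h <;> simp [h]

theorem isEvenDifference_diffGens {N A : ℕ} (hA : 1 ≤ A) {g : ℕ → ℝ} (hg : g ∈ diffGens N A) :
    IsEvenDifference N A g := by
  rcases hg with ⟨a, i, ha, haA, hi, rfl⟩ | ⟨i, hi, hiN, rfl⟩
  · have m1 : (i : ℤ) ∈ symIcc N := by simp [symIcc]; omega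
    have m2 : (-(i + 1) : ℤ) ∈ symIcc N := by simp [symIcc]; omega
    have m3 : (i + 1 : ℤ) ∈ symIcc N := by simp [symIcc]; omega
    have m4 : (-i : ℤ) ∈ symIcc N := by simp [symIcc]; omega
    -- `h` is read off from `oddDiff_eq`. In h(x) + h(x+1) the shifts are i, i + 1, -i, -(i + 1), a
    -- set stable under negation, and the signs (-1)^a make the sum even.
    refine ⟨fun x => -clampedPow N a i x - (-1) ^ a * clampedPow N a (-(i + 1)) x,
      fun x => ?_, ?_, fun x => ?_,
      -(cofactor N A a i + (-1) ^ a * cofactor N A a (-i) +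
        (cofactor N A a (i + 1) + (-1) ^ a * cofactor N A a (-(i + 1)))), ?_, ?_, fun x hx => ?_⟩
    · obtain ⟨r, hr⟩ := clampedPow_rational N a i x
      obtain ⟨r', hr'⟩ := clampedPow_rational N a (-(i + 1)) x
      exact ⟨-r - (-1) ^ a * r', by simp only [hr, hr']; push_cast; rfl⟩
    · simpa using (tendsto_clampedPow N ha i).neg.sub
        ((tendsto_clampedPow N ha (-(i + 1))).const_mul ((-1) ^ a))
    · rw [oddDiff_eq]; ring
    · have h1 := natDegree_cofactor_add_one_le ha haA m1
      have h2 := natDegree_cofactor_add_one_le ha haA m2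
      have h3 := natDegree_cofactor_add_one_le ha haA m3
      have h4 := natDegree_cofactor_add_one_le ha haA m4
      have h2' := natDegree_neg_one_pow_mul_le a (cofactor N A a (-(i + 1)))
      have h4' := natDegree_neg_one_pow_mul_le a (cofactor N A a (-i))
      rw [natDegree_neg]
      have : ∀ p q : ℚ[X], p.natDegree + 1 ≤ A * (2 * N + 1) → q.natDegree + 1 ≤ A * (2 * N + 1) →
          (p + q).natDegree + 1 ≤ A * (2 * N + 1) := fun p q hp hq => by
        have := natDegree_add_le p q
        have := max_le (show p.natDegree ≤ A * (2 * N + 1) - 1 by omega)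
          (show q.natDegree ≤ A * (2 * N + 1) - 1 by omega)
        omega
      exact this _ _ (this _ _ h1 (by omega)) (this _ _ h3 (by omega))
    · have e := neg_one_pow_mul_self_poly a
      simp only [neg_comp, add_comp, mul_comp, pow_comp, one_comp, cofactor_comp_neg haA m1,
        cofactor_comp_neg haA m2, cofactor_comp_neg haA m3, cofactor_comp_neg haA m4, neg_neg,
        pow_add]
      linear_combination (-(-1) ^ A * (cofactor N A a i + cofactor N A a (i + 1))) * e
    · simp only [ratioFun, if_pos hx, map_neg, map_add, map_mul, map_pow, map_one, neg_div, add_div,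
        mul_div_assoc, aeval_cofactor_div hx haA m1, aeval_cofactor_div hx haA m2,
        aeval_cofactor_div hx haA m3, aeval_cofactor_div hx haA m4]
      rw [clampedPow_of_lt hx, clampedPow_of_lt hx, clampedPow_of_lt (by omega),
        clampedPow_of_lt (by omega)]
      push_cast
      ring_nf
  -- The indicator of i is the difference of a step function that vanishes beyond N, so `Q` = 0.
  · refine ⟨fun x => if x ≤ i then 1 else 0, fun x => ?_, ?_, fun x => ?_, 0, ?_, by simp,
      fun x hx => ?_⟩
    · by_cases h : x ≤ i
      · exact ⟨1, by simp [h]⟩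
      · exact ⟨0, by simp [h]⟩
    · refine tendsto_const_nhds.congr' ?_
      filter_upwards [eventually_gt_atTop i] with x hx
      simp [show ¬ x ≤ i by omega]
    · rcases lt_trichotomy (x + 1) i with h | h | h
      · simp [h.le, h.ne, show x + 2 ≤ i by omega]
      · simp [h, show ¬ x + 2 ≤ i by omega]
      · simp [h.ne', show ¬ x + 1 ≤ i by omega, show ¬ x + 2 ≤ i by omega]
    · have := Nat.mul_pos hA (show 0 < 2 * N + 1 by omega)
      rw [natDegree_zero]; omega
    · simp [ratioFun, show ¬ x ≤ i by omega, show ¬ x + 1 ≤ i by omega]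

theorem clampedPow_eq_ratioFun {N A a x : ℕ} (haA : a ≤ A) {j : ℤ} (hj : j ∈ symIcc N)
    (hx : N < x) : clampedPow N a j x = ratioFun N A (cofactor N A a j) x := by
  rw [clampedPow_of_lt hx, ratioFun, if_pos hx, aeval_cofactor_div hx haA hj]

theorem exists_poly_oddShift {N A a : ℕ} (ha : 1 ≤ a) (haA : a ≤ A) {j : ℤ}
    (hj : j ∈ symIcc N) :
    ∃ Q : ℚ[X], Q.natDegree + 1 ≤ A * (2 * N + 1) ∧ Q.comp (-X) = (-1) ^ (A + 1) * Q ∧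
      ∀ x, oddShift N a j x = ratioFun N A Q x := by
  have hj' := neg_mem_symIcc hj
  refine ⟨cofactor N A a j - (-1) ^ a * cofactor N A a (-j), ?_, ?_, fun x => ?_⟩
  · have h1 := natDegree_cofactor_add_one_le ha haA hj
    have h2 := natDegree_cofactor_add_one_le ha haA hj'
    have h2' := natDegree_neg_one_pow_mul_le a (cofactor N A a (-j))
    have := natDegree_sub_le (cofactor N A a j) ((-1) ^ a * cofactor N A a (-j))
    have := max_le (show (cofactor N A a j).natDegree ≤ A * (2 * N + 1) - 1 by omega)
      (show ((-1) ^ a * cofactor N A a (-j)).natDegree ≤ A * (2 * N + 1) - 1 by omega)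
    omega
  · have e := neg_one_pow_mul_self_poly a
    simp only [neg_comp, sub_comp, mul_comp, pow_comp, one_comp, cofactor_comp_neg haA hj,
      cofactor_comp_neg haA hj', neg_neg, pow_add]
    linear_combination (-(-1) ^ A * cofactor N A a j) * e
  · by_cases hx : N < x
    · simp only [oddShift, ratioFun, if_pos hx, map_sub, map_mul, map_pow, map_neg, map_one, sub_div,
        mul_div_assoc, aeval_cofactor_div hx haA hj, aeval_cofactor_div hx haA hj']
      push_cast
      ring_nf
    · simp [oddShift, ratioFun, hx]

theorem isOddRatio_diffGens {N A : ℕ} (hA : 1 ≤ A) {f : ℕ → ℝ} (hf : f ∈ diffGens N A) :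
    IsOddRatio N A f := by
  rcases hf with ⟨a, i, ha, haA, hi, rfl⟩ | ⟨i, hi, hiN, rfl⟩
  · have m1 : (i : ℤ) ∈ symIcc N := by simp [symIcc]; omega
    have m3 : (i + 1 : ℤ) ∈ symIcc N := by simp [symIcc]; omega
    refine ⟨fun x => ?_, ?_⟩
    · rw [oddDiff_eq]
      obtain ⟨r, hr⟩ := clampedPow_rational N a i x
      obtain ⟨r', hr'⟩ := clampedPow_rational N a (-(i + 1)) x
      obtain ⟨s, hs⟩ := clampedPow_rational N a i (x + 1)
      obtain ⟨s', hs'⟩ := clampedPow_rational N a (-(i + 1)) (x + 1)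
      exact ⟨-(r - s) - (-1) ^ a * (r' - s'), by rw [hr, hr', hs, hs']; push_cast; rfl⟩
    · obtain ⟨Q, h1, h2, h3⟩ := exists_poly_oddShift ha haA m1
      obtain ⟨Q', h1', h2', h3'⟩ := exists_poly_oddShift ha haA m3
      refine ⟨Q' - Q, ?_, ?_, fun x hx => ?_⟩
      · have := natDegree_sub_le Q' Q
        have := max_le (show Q'.natDegree ≤ A * (2 * N + 1) - 1 by omega)
          (show Q.natDegree ≤ A * (2 * N + 1) - 1 by omega)
        omega
      · rw [sub_comp, h2, h2', mul_sub]
      · rw [oddDiff, Pi.sub_apply, h3, h3']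
        simp [ratioFun, hx, sub_div]
  · refine ⟨fun x => ?_, 0, ?_, by simp, fun x hx => ?_⟩
    · by_cases h : x = i
      · exact ⟨1, by simp [h]⟩
      · exact ⟨0, by simp [h]⟩
    · have := Nat.mul_pos hA (show 0 < 2 * N + 1 by omega)
      rw [natDegree_zero]; omega
    · simp [ratioFun, show x ≠ i by omega]

theorem isOddRatio_powGens {N A : ℕ} {f : ℕ → ℝ} (hf : f ∈ powGens A) : IsOddRatio N A f := by
  obtain ⟨a, ha, ha3, haA, rfl⟩ := hf
  have m : (0 : ℤ) ∈ symIcc N := by simp [symIcc]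
  refine ⟨fun x => ⟨1 / (x : ℚ) ^ a, by push_cast; rfl⟩, cofactor N A a 0,
    natDegree_cofactor_add_one_le (by omega) haA m, ?_, fun x hx => ?_⟩
  · rw [cofactor_comp_neg haA m, pow_add, pow_add, ha.neg_one_pow]; simp
  · rw [← clampedPow_eq_ratioFun haA m hx, clampedPow_of_lt hx]; simp

theorem exists_hasSum_gens {N A : ℕ} {f : ℕ → ℝ} (hf : f ∈ diffGens N A ∪ powGens A) :
    ∃ S ∈ oddZetaSpan (2 * A - 1), HasSum (fun x => f (x + 1)) S := by
  rcases hf with (hf | ⟨i, hi, hiN, rfl⟩) | ⟨a, ha, ha3, haA, rfl⟩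
  · obtain ⟨S, hS, h⟩ := exists_hasSum_of_mem_span (B := A) (Submodule.subset_span (Or.inl hf))
    refine ⟨S, Submodule.span_mono (Set.insert_subset_insert ?_) hS, h⟩
    rintro x ⟨s, h1, h2, h3, rfl⟩
    exact ⟨s, h1, h2, by omega, rfl⟩
  · refine ⟨1, Submodule.subset_span (Set.mem_insert _ _), ?_⟩
    have := hasSum_ite_eq (i - 1) (1 : ℝ)
    refine hasSum_of_eq this fun x => ?_
    by_cases h : x = i - 1
    · simp [h, show i - 1 + 1 = i by omega]
    · simp [h, show x + 1 ≠ i by omega]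
  · exact ⟨_, zeta_mem_oddZetaSpan ha ha3 (by omega), hasSum_one_div_pow (by omega)⟩

theorem summable_gens {N A : ℕ} {f : ℕ → ℝ} (hf : f ∈ diffGens N A ∪ powGens A) :
    Summable f := by
  obtain ⟨S, -, h⟩ := exists_hasSum_gens hf
  exact (summable_nat_add_iff 1).1 h.summable

theorem detSum_gens_mem_span {N A : ℕ} (hA : 1 ≤ A) {p : ℕ} (f : Fin p → ℕ → ℝ)
    (hf : ∀ i, f i ∈ diffGens N A ∪ powGens A) :
    detSum f ∈ Submodule.span ℚ (zetaProducts A p) := by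
  let ev : {f : ℕ → ℝ // f ∈ diffGens N A ∪ powGens A} → ℕ → ℝ := fun f => f.1
  have hev : ∀ f, Summable (ev f) := fun f => summable_gens f.2
  refine detSum_mem_span ev {f | f.1 ∈ diffGens N A} A hev
    (fun g hg => tsum_rational ev hev (isEvenDifference_diffGens hA hg))
    (fun g hg f => infPairing_mem ev (isEvenDifference_diffGens hA hg)
      (f.2.elim (isOddRatio_diffGens hA) isOddRatio_powGens) (exists_hasSum_gens f.2))
    (fun f hf' => f.2.resolve_left hf') fun i => ⟨f i, hf i⟩

/-- Indicators of 1, …, N restore the truncated values. The untruncated power is needed to obtain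
genuine multiple zeta values, and the indicators are harmless since they are differences too. -/
theorem truncPow_mem_span_gens {N A b : ℕ} (hb : Odd b) (h3 : 3 ≤ b) (hbA : b ≤ A) :
    truncPow N b ∈ Submodule.span ℚ (diffGens N A ∪ powGens A) := by
  have h : truncPow N b = (fun x : ℕ => 1 / (x : ℝ) ^ b) -
      ∑ i ∈ Finset.Icc 1 N, (1 / (i : ℚ) ^ b) • (Pi.single i 1 : ℕ → ℝ) := by
    funext x
    simp only [truncPow, Pi.sub_apply, Finset.sum_apply, Pi.smul_apply, Rat.smul_def,
      Pi.single_apply, mul_ite, mul_one, mul_zero, Finset.sum_ite_eq, Finset.mem_Icc]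
    by_cases hx : N < x
    · simp [hx, show ¬ x ≤ N by omega]
    -- At x = 0 both sides are 0 by the convention 1 / 0 = 0, as b ≠ 0.
    · rcases Nat.eq_zero_or_pos x with rfl | h0
      · simp [show b ≠ 0 by omega]
      · rw [if_neg hx, if_pos ⟨h0, by omega⟩]
        push_cast
        rw [sub_self]
  rw [h]
  refine sub_mem (Submodule.subset_span (Or.inr ⟨b, hb, h3, hbA, rfl⟩))
    (Submodule.sum_mem _ fun i hi => Submodule.smul_mem _ _ (Submodule.subset_span (Or.inl (Or.inr
      ⟨i, (Finset.mem_Icc.1 hi).1, (Finset.mem_Icc.1 hi).2, rfl⟩))))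

theorem exists_hasSum_ratioFun {N A : ℕ} (hA : 1 ≤ A) {p : ℕ} (Q : Fin p → ℚ[X])
    (hdeg : ∀ i, (Q i).natDegree + 2 ≤ A * (2 * N + 1))
    (hodd : ∀ i, (Q i).comp (-X) = (-1) ^ (A + 1) * Q i) :
    ∃ S ∈ Submodule.span ℚ (zetaProducts A p),
      HasSum (fun k : strictTuples p => evalDet (fun i => ratioFun N A (Q i)) k) S := by
  refine exists_hasSum_evalDet (diffGens N A ∪ powGens A) _ (fun f hf =>
    ⟨_, detSum_gens_mem_span hA f hf, hasSum_detSum f fun i => summable_gens (hf i)⟩) _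
    fun i => ?_
  refine (Submodule.span_le.2 ?_) (ratioFun_mem_span N A (Q i) (hdeg i) (hodd i))
  rintro f (hf | ⟨b, hb, h3, hbA, rfl⟩)
  · exact Submodule.subset_span (Or.inl (Or.inl hf))
  · exact truncPow_mem_span_gens hb h3 hbA

end Generators

/-! ### Averaging the polynomial over reflections. -/

section Symmetrization

theorem aeval_perm {n A p : ℕ} {P : MvPolynomial (Fin p) ℚ} (hP : P ∈ polySet n A p)
    (σ : Equiv.Perm (Fin p)) (y : Fin p → ℝ) :
    MvPolynomial.aeval (fun i => y (σ i)) P =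
      ((Equiv.Perm.sign σ : ℤ) : ℝ) * MvPolynomial.aeval y P := by
  have h := congrArg (MvPolynomial.aeval y) (hP.1 σ)
  rw [MvPolynomial.comp_aeval_apply, map_smul, Rat.smul_def] at h
  simpa using h

theorem aeval_update {n A p : ℕ} {P : MvPolynomial (Fin p) ℚ} (hP : P ∈ polySet n A p)
    (j : Fin p) (y : Fin p → ℝ) :
    MvPolynomial.aeval (Function.update y j (-y j - n)) P =
      (-1) ^ (A * (n + 1) + 1) * MvPolynomial.aeval y P := by
  have h := congrArg (MvPolynomial.aeval y) (hP.2 j)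
  rw [MvPolynomial.comp_aeval_apply, map_smul, Rat.smul_def] at h
  push_cast at h
  rw [← h]
  congr 2
  funext i
  by_cases hi : i = j
  · subst hi; simp
  · simp [hi]

theorem aeval_flip {n A p : ℕ} {P : MvPolynomial (Fin p) ℚ} (hP : P ∈ polySet n A p)
    (y : Fin p → ℝ) (u : Finset (Fin p)) :
    MvPolynomial.aeval (fun i => if i ∈ u then -y i - n else y i) P =
      ((-1) ^ (A * (n + 1) + 1)) ^ u.card * MvPolynomial.aeval y P := by
  induction u using Finset.induction_on with
  | empty => simp
  | insert j u hj ih =>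
    rw [Finset.card_insert_of_notMem hj, pow_succ', mul_assoc, ← ih, ← aeval_update hP j]
    congr 2
    funext i
    by_cases hi : i = j
    · subst hi; simp [hj]
    · simp [hi]

/-- All 2^p reflections, indexed by the set `u` of reflected variables, give the same value up to
sign; summing each monomial over `u` factors into one-variable terms. -/
theorem aeval_symmetrize {n A p : ℕ} {P : MvPolynomial (Fin p) ℚ} (hP : P ∈ polySet n A p)
    (y : Fin p → ℝ) :
    (2 : ℝ) ^ p * MvPolynomial.aeval y P = ∑ m ∈ P.support, ((P.coeff m : ℚ) : ℝ) *
      ∏ i, (y i ^ m i + (-1) ^ (A * (n + 1) + 1) * (-y i - n) ^ m i) := by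
  set s : ℝ := (-1) ^ (A * (n + 1) + 1) with hs
  have hss : s * s = 1 := by rw [hs, ← mul_pow]; simp
  have h1 : ∀ u : Finset (Fin p), s ^ u.card *
      MvPolynomial.aeval (fun i => if i ∈ u then -y i - n else y i) P =
        MvPolynomial.aeval y P := fun u => by
    rw [aeval_flip hP, ← hs, ← mul_assoc, ← mul_pow, hss, one_pow, one_mul]
  calc (2 : ℝ) ^ p * MvPolynomial.aeval y P
      = ∑ u ∈ (Finset.univ : Finset (Fin p)).powerset, s ^ u.card *
          MvPolynomial.aeval (fun i => if i ∈ u then -y i - n else y i) P := by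
        simp [h1]
    _ = ∑ u ∈ (Finset.univ : Finset (Fin p)).powerset, ∑ m ∈ P.support, ((P.coeff m : ℚ) : ℝ) *
          (s ^ u.card * ∏ i, (if i ∈ u then -y i - n else y i) ^ m i) := by
        refine Finset.sum_congr rfl fun u _ => ?_
        rw [MvPolynomial.aeval_def, MvPolynomial.eval₂_eq', Finset.mul_sum]
        refine Finset.sum_congr rfl fun m _ => ?_
        simp; ring
    _ = _ := by
        rw [Finset.sum_comm]
        refine Finset.sum_congr rfl fun m _ => ?_
        rw [← Finset.mul_sum]
        congr 1
        simp only [add_comm (y _ ^ _)]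
        rw [Finset.prod_add]
        refine Finset.sum_congr rfl fun u _ => ?_
        rw [Finset.prod_mul_distrib, Finset.prod_const, mul_assoc]
        congr 1
        rw [← Finset.prod_mul_prod_compl u fun i => (if i ∈ u then -y i - n else y i) ^ m i]
        congr 1
        · exact Finset.prod_congr rfl fun i hi => by simp [hi]
        · rw [← Finset.compl_eq_univ_sdiff]
          exact Finset.prod_congr rfl fun i hi => by simp [Finset.mem_compl.1 hi]

end Symmetrization

/-! ### Centring at x = k + N and conclusion. -/

section Shift

open Polynomial

/-- The polynomial `(X - N) ^ d + (-1) ^ (A + 1) (-X - N) ^ d`. -/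
noncomputable def symPow (N A d : ℕ) : ℚ[X] :=
  (X - C (N : ℚ)) ^ d + (-1) ^ (A + 1) * (-X - C (N : ℚ)) ^ d

theorem symPow_comp_neg (N A d : ℕ) :
    (symPow N A d).comp (-X) = (-1) ^ (A + 1) * symPow N A d := by
  simp only [symPow, add_comp, mul_comp, pow_comp, sub_comp, neg_comp, X_comp, C_comp,
    one_comp, neg_neg, mul_add, ← mul_assoc, neg_one_pow_mul_self_poly]
  ring

theorem natDegree_symPow_le (N A d : ℕ) : (symPow N A d).natDegree ≤ d := by
  have h1 : (X - C (N : ℚ)).natDegree ≤ 1 := natDegree_X_sub_C_le _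
  have h2 : (-X - C (N : ℚ)).natDegree ≤ 1 := by
    rw [← neg_add', natDegree_neg]; exact (natDegree_X_add_C _).le
  refine (natDegree_add_le _ _).trans (max_le ?_
    ((natDegree_neg_one_pow_mul_le _ _).trans ?_))
  · simpa using natDegree_pow_le_of_le d h1
  · simpa using natDegree_pow_le_of_le d h2

theorem aeval_symPow (N A d k : ℕ) : aeval ((k + N : ℕ) : ℝ) (symPow N A d) =
    (k : ℝ) ^ d + (-1) ^ (A * (N + N + 1) + 1) * (-(k : ℝ) - ((N + N : ℕ) : ℝ)) ^ d := by
  -- As 2N + 1 is odd, only the parity of A + 1 matters.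
  have h : (-1 : ℝ) ^ (A * (N + N + 1) + 1) = (-1) ^ (A + 1) := by
    rw [show A * (N + N + 1) + 1 = 2 * (A * N) + (A + 1) by ring, pow_add, pow_mul]; simp
  rw [h]
  simp only [symPow, map_add, map_sub, map_mul, map_pow, map_neg, map_one, aeval_X, aeval_C]
  push_cast
  ring_nf

theorem ascPochhammer_eval_prod (m : ℕ) (x : ℝ) :
    (ascPochhammer ℝ m).eval x = ∏ j ∈ Finset.range m, (x + j) := by
  induction m with
  | zero => simp
  | succ m ih => rw [ascPochhammer_succ_eval, ih, Finset.prod_range_succ]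

theorem aeval_centralPoly_shift (N k : ℕ) :
    aeval ((k + N : ℕ) : ℝ) (centralPoly N) = (ascPochhammer ℝ (N + N + 1)).eval (k : ℝ) := by
  rw [ascPochhammer_eval_prod, centralPoly, map_prod]
  refine (Finset.prod_nbij' (fun j : ℕ => (j : ℤ) - N) (fun j => (j + N).toNat) ?_ ?_ ?_ ?_ ?_).symm
  · intro j hj; simp only [symIcc, Finset.mem_Icc, Finset.mem_range] at *; omega
  · intro j hj; simp only [symIcc, Finset.mem_Icc, Finset.mem_range] at *; omega
  · intro j hj; simp
  · intro j hj; simp only [symIcc, Finset.mem_Icc] at *; omega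
  · intro j hj; simp

theorem evalDet_ratioFun_shift (N A : ℕ) {p : ℕ} (Q : Fin p → ℚ[X]) (k : Fin p → ℕ)
    (hk : ∀ i, 1 ≤ k i) :
    evalDet (fun i => ratioFun N A (Q i)) (fun i => k i + N) =
      (Matrix.of fun i j => aeval ((k j + N : ℕ) : ℝ) (Q i)).det /
        ∏ i, (ascPochhammer ℝ (N + N + 1)).eval (k i : ℝ) ^ A := by
  have h : (Matrix.of fun i j => ratioFun N A (Q i) (k j + N)) =
      Matrix.of fun i j => ((ascPochhammer ℝ (N + N + 1)).eval (k j : ℝ) ^ A)⁻¹ *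
        (Matrix.of fun i j => aeval ((k j + N : ℕ) : ℝ) (Q i)) i j := by
    ext i j
    have := hk j
    simp only [Matrix.of_apply, ratioFun, aeval_centralPoly_shift,
      if_pos (show N < k j + N by omega)]
    rw [div_eq_inv_mul]
  rw [evalDet, h, Matrix.det_mul_row, Finset.prod_inv_distrib, div_eq_inv_mul]

theorem evalDet_ratioFun_eq_zero (N A : ℕ) {p : ℕ} (Q : Fin p → ℚ[X]) (k : Fin p → ℕ)
    (i : Fin p) (hi : k i ≤ N) : evalDet (fun i => ratioFun N A (Q i)) k = 0 := by
  refine Matrix.det_eq_zero_of_column_eq_zero i fun j => ?_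
  simp [ratioFun, hi]

/-- Antisymmetrizing over the p! permutations turns each product of one-variable factors into a
determinant. -/
theorem factorial_mul_aeval {N A p : ℕ} {P : MvPolynomial (Fin p) ℚ}
    (hP : P ∈ polySet (N + N) A p) (k : Fin p → ℕ) :
    (p.factorial : ℝ) * ((2 : ℝ) ^ p * MvPolynomial.aeval (fun i => (k i : ℝ)) P) =
      ∑ m ∈ P.support, ((P.coeff m : ℚ) : ℝ) *
        (Matrix.of fun i j => aeval ((k j + N : ℕ) : ℝ) (symPow N A (m i))).det := by
  have h1 : ∀ σ : Equiv.Perm (Fin p), (2 : ℝ) ^ p * MvPolynomial.aeval (fun i => (k i : ℝ)) P =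
      ((Equiv.Perm.sign σ : ℤ) : ℝ) * ∑ m ∈ P.support, ((P.coeff m : ℚ) : ℝ) *
        ∏ i, aeval ((k (σ i) + N : ℕ) : ℝ) (symPow N A (m i)) := fun σ => by
    simp only [aeval_symPow]
    rw [← aeval_symmetrize hP fun i => (k (σ i) : ℝ), aeval_perm hP σ fun i => (k i : ℝ)]
    rcases Int.units_eq_one_or (Equiv.Perm.sign σ) with hs | hs <;> simp [hs]
  have h2 : (p.factorial : ℝ) * ((2 : ℝ) ^ p * MvPolynomial.aeval (fun i => (k i : ℝ)) P) =
      ∑ _σ : Equiv.Perm (Fin p), (2 : ℝ) ^ p * MvPolynomial.aeval (fun i => (k i : ℝ)) P := by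
    simp [Fintype.card_perm]
  rw [h2, Finset.sum_congr rfl fun σ _ => h1 σ]
  simp only [Finset.mul_sum]
  rw [Finset.sum_comm]
  refine Finset.sum_congr rfl fun m _ => ?_
  rw [← Matrix.det_transpose, Matrix.det_apply', Finset.mul_sum]
  refine Finset.sum_congr rfl fun σ _ => ?_
  simp only [Matrix.transpose_apply, Matrix.of_apply]
  ring

theorem seriesTerm_eq {N A p : ℕ} {P : MvPolynomial (Fin p) ℚ}
    (hP : P ∈ polySet (N + N) A p) (k : Fin p → ℕ) (hk : ∀ i, 1 ≤ k i) :
    seriesTerm (N + N) A P k = ∑ m ∈ P.support, (P.coeff m / (p.factorial * 2 ^ p) : ℚ) •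
      evalDet (fun i => ratioFun N A (symPow N A (m i))) (fun i => k i + N) := by
  have h := factorial_mul_aeval hP k
  have hp : (p.factorial : ℝ) ≠ 0 := by exact_mod_cast p.factorial_ne_zero
  have h' : MvPolynomial.aeval (fun i => (k i : ℝ)) P = (∑ m ∈ P.support, ((P.coeff m : ℚ) : ℝ) *
      (Matrix.of fun i j => aeval ((k j + N : ℕ) : ℝ) (symPow N A (m i))).det) /
        (p.factorial * 2 ^ p) := by
    rw [← h]; field_simp
  rw [seriesTerm, h', Finset.sum_div, Finset.sum_div]
  refine Finset.sum_congr rfl fun m _ => ?_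
  rw [evalDet_ratioFun_shift N A _ k hk, Rat.smul_def]
  push_cast
  ring

/-- Swapping two equal arguments negates P without moving the point. -/
theorem seriesTerm_eq_zero {n A p : ℕ} {P : MvPolynomial (Fin p) ℚ} (hP : P ∈ polySet n A p)
    {k : Fin p → ℕ} {i j : Fin p} (hij : i ≠ j) (h : k i = k j) : seriesTerm n A P k = 0 := by
  have h1 := aeval_perm hP (Equiv.swap i j) fun i => (k i : ℝ)
  have h2 : (fun l => (k (Equiv.swap i j l) : ℝ)) = fun l => (k l : ℝ) := by
    funext l
    by_cases hi : l = i
    · subst hi; simp [h]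
    · by_cases hj : l = j
      · subst hj; simp [h]
      · rw [Equiv.swap_apply_of_ne_of_ne hi hj]
  rw [h2, Equiv.Perm.sign_swap hij] at h1
  have h3 : MvPolynomial.aeval (fun l => (k l : ℝ)) P = 0 := by
    push_cast at h1; linarith
  rw [seriesTerm, h3, zero_div]

theorem exists_hasSum_seriesTerm {N A p : ℕ} (hA : 1 ≤ A) (P : MvPolynomial (Fin p) ℚ)
    (hP : P ∈ polySet (N + N) A p)
    (hdeg : ∀ m ∈ P.support, ∀ i, m i + 2 ≤ A * (N + N + 1)) :
    ∃ S : ℝ, HasSum (fun k : {k : Fin p → ℕ // Antitone k ∧ ∀ i, 1 ≤ k i} =>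
        seriesTerm (N + N) A P k.1) S ∧ S ∈ Submodule.span ℚ (zetaProducts A p) := by
  have hex : ∀ m ∈ P.support, ∃ S ∈ Submodule.span ℚ (zetaProducts A p),
      HasSum (fun k : strictTuples p =>
        evalDet (fun i => ratioFun N A (symPow N A (m i))) k) S := fun m hm =>
    exists_hasSum_ratioFun hA _ (fun i => by
      have h1 := hdeg m hm i
      have h2 := natDegree_symPow_le N A (m i)
      rw [two_mul]; omega) fun i => symPow_comp_neg N A (m i)
  choose! S hS hsum using hex
  let ψ : (Fin p → ℕ) → ℝ := fun x => ∑ m ∈ P.support, (P.coeff m / (p.factorial * 2 ^ p) : ℚ) •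
    evalDet (fun i => ratioFun N A (symPow N A (m i))) x
  have hψ : HasSum (fun k : strictTuples p => ψ k)
      (∑ m ∈ P.support, (P.coeff m / (p.factorial * 2 ^ p) : ℚ) • S m) :=
    hasSum_sum fun m hm => (hsum m hm).const_smul _
  have hψ0 : ∀ x i, x i ≤ N → ψ x = 0 := fun x i hi =>
    Finset.sum_eq_zero fun m _ => by
      rw [evalDet_ratioFun_eq_zero N A _ x i hi, smul_zero]
  refine ⟨∑ m ∈ P.support, (P.coeff m / (p.factorial * 2 ^ p) : ℚ) • S m, ?_,
    Submodule.sum_mem _ fun m hm => Submodule.smul_mem _ _ (hS m hm)⟩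
  replace hψ := (hasSum_subtype_iff_indicator (f := ψ) (s := strictTuples p)).1 hψ
  refine (hasSum_subtype_iff_indicator (f := seriesTerm (N + N) A P)
    (s := {k | Antitone k ∧ ∀ i, 1 ≤ k i})).2 ?_
  let τ : (Fin p → ℕ) → Fin p → ℕ := fun k i => k i + N
  have hτ : Function.Injective τ := fun k k' h => funext fun i => by
    have := congrFun h i
    simpa [τ] using this
  -- Reindexing by the shift loses nothing: `ψ` vanishes off the range of `τ`, where some entry is
  -- below N, thanks to the truncation in `ratioFun`.
  rw [← hτ.hasSum_iff] at hψ
  · convert hψ using 1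
    funext k
    rw [Function.comp_apply]
    by_cases h1 : ∀ i, 1 ≤ k i
    · have hst : seriesTerm (N + N) A P k = ψ (τ k) := seriesTerm_eq hP k h1
      by_cases h2 : StrictAnti k
      · have m1 : k ∈ {k : Fin p → ℕ | Antitone k ∧ ∀ i, 1 ≤ k i} := ⟨h2.antitone, h1⟩
        have m2 : τ k ∈ strictTuples p :=
          ⟨fun i j hij => Nat.add_lt_add_right (h2 hij) N, fun i => (h1 i).trans (by simp [τ])⟩
        rw [Set.indicator_of_mem m1, Set.indicator_of_mem m2, hst]
      · have m2 : τ k ∉ strictTuples p := fun h =>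
          h2 fun i j hij => Nat.lt_of_add_lt_add_right (h.1 hij)
        rw [Set.indicator_of_notMem m2]
        refine Set.indicator_apply_eq_zero.2 fun h => ?_
        have hinj : ¬ Function.Injective k := fun hi => h2 (h.1.strictAnti_of_injective hi)
        simp only [Function.Injective, not_forall] at hinj
        obtain ⟨i, j, hij, hne⟩ := hinj
        exact seriesTerm_eq_zero hP hne hij
    · have m1 : k ∉ {k : Fin p → ℕ | Antitone k ∧ ∀ i, 1 ≤ k i} := fun h => h1 h.2
      rw [Set.indicator_of_notMem m1]
      push Not at h1
      obtain ⟨i, hi⟩ := h1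
      exact (Set.indicator_apply_eq_zero.2 fun _ => hψ0 _ i (by simp only [τ]; omega)).symm
  · intro x hx
    refine Set.indicator_apply_eq_zero.2 fun _ => ?_
    by_contra hne
    refine hx ⟨fun i => x i - N, funext fun i => ?_⟩
    have : N < x i := by
      by_contra h
      exact hne (hψ0 x i (by omega))
    simp only [τ]; omega

end Shift

end Polyzeta

theorem mainTheorem1 (n A p : ℕ) (hn : Even n) (hA : 1 ≤ A) (hp : 1 ≤ p)
    (P : MvPolynomial (Fin p) ℚ) (hP : P ∈ Polyzeta.polySet n A p)
    -- every exponent of `P` in each variable is at most `A (n + 1) - 2` (also satisfied by `P = 0`)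
    (hdeg : ∀ m ∈ P.support, ∀ i, m i + 2 ≤ A * (n + 1)) :
    ∃ S : ℝ,
      HasSum (fun k : {k : Fin p → ℕ // Antitone k ∧ ∀ i, 1 ≤ k i} =>
        Polyzeta.seriesTerm n A P k.1) S ∧
      S ∈ Submodule.span ℚ (Polyzeta.zetaProducts A p) := by
  obtain ⟨N, rfl⟩ := hn
  exact Polyzeta.exists_hasSum_seriesTerm hA P hP hdeg
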